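/- **Setting.** There are $n=2f+1$ replicas, at most $f$ of which are Byzantine; the others are honest. Signatures of honest replicas cannot be forged. A message sent by an honest replica to an honest replica arrives within $\Delta>0$; honest replicas start at most $\Delta$ apart; a replica has the messages it sends to itself at once and receives only finitely many messages in any bounded time. A block $B_k=(b_k,H(B_{k-1}))$ consists of a batch $b_k$ and a collision-free hash of its parent, so it determines its chain of ancestors down to genesis. An application rule says which blocks are valid, and honest replicas can always generate a valid child of any block. A block *extends* its ancestors and itself; two blocks are *equivocating* if neither extends the other. A proposal $\langle\mathtt{propose},B,S,v\rangle_L$ signed by the leader $L$ of view $v$ is *valid* if $B$ is a valid non-genesis block and $S$ is $\bot$ or a set of $f+1$ $\mathtt{status}$ messages (see below) of distinct signers for the change from view $v-1$ to $v$, each with a certificate of a view $\le v-1$. Two proposals of one view signed by its leader are equivocating if their blocks are, or if they are distinct and both have $S\neq\bot$. A certificate $\mathcal C_v(B)$ is a set of votes for $B$ in view $v$ by $f+1$ distinct replicas, a blame certificate $\mathcal B_v$ a set of blames of view $v$ by $f+1$ distinct replicas. Certified blocks are ranked by view, then by height; genesis counts as certified and ranks lowest. Views are $1,2,\dots$, and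 the leader of view $v$ is replica $v \bmod n$. **Protocol $1\Delta$-SMR** (parameter $\alpha>0$), for an honest replica in view $v$ with leader $L$: 1. *Propose.* $L$ signs and sends to all a proposal $\langle\mathtt{propose},B,S,v\rangle_L$ every $\alpha$ time. The first is sent on entering view $v=1$, with $S=\bot$ and parent genesis, or $2\Delta$ after entering view $v>1$, with $S$ a set of $f+1$ received $\mathtt{status}$ messages of distinct signers that includes the highest certified block of all received ones, which is the parent. Each later proposal has $S=\bot$ and as parent the last block proposed. 2. *Forward.* On receiving a valid proposal, forward it to all. Once the chain that $B$ extends is known, and $B$ extends the highest certified block in $S$ (if $S\ne\bot$) or the highest certified block known to the replica (if $S=\bot$), broadcast the blocks of that chain not forwarded before and start a vote-timer of length $\Delta$. 3. *Vote.* When the timer expires, broadcast a vote for $B$, unless equivocating blocks/proposals of $L$ in view $v$ or $\mathcal B_v$ have been received. 4. *Commit.* On receiving $f+1$ votes for $B$ in view $v$ under the same condition, broadcast $\mathcal C_v(B)$ and commit $B$ and all its ancestors. 5. *Blame.* If, for some $p\ge 1$, fewer than $p$ new blocks have been committed in view $v$ within time $6\Delta+(p-1)\alpha$ after entering it, broadcast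 $\langle\mathtt{blame},v\rangle$; on receiving equivocating blocks/proposals of $L$ in view $v$, broadcast $\langle\mathtt{blame},v\rangle$ and the two proposals. 6. *New-view.* On receiving $\mathcal B_v$, broadcast it, stop the vote-timers and stop voting in view $v$, and enter view $v+1$ after $2\Delta$. On entering, send the leader of view $v+1$ a signed $\mathtt{status}$ message with the highest known block certified in a view $\le v$ and its certificate. From then on ignore certificates of views $\le v$, except those in the sets $S$ of proposals of later views and in the $\mathtt{status}$ messages from which a leader forms $S$. A step that is due at the very instant at which $\mathcal B_v$ arrives is still executed. **Theorem (Liveness of $1\Delta$-SMR).** In every execution of $1\Delta$-SMR: 1. All honest replicas keep committing new blocks: for every honest replica and every time $t$ there is a block that it has not committed by time $t$ but commits later. 2. If the leader of view $v$ is honest, then every honest replica that enters view $v$ commits, for every $p\ge1$, at least $p$ new blocks (blocks it did not commit in an earlier view) within time $6\Delta+(p-1)\alpha$ after entering view $v$; no honest replica ever blames the leader in view $v$; and no honest replica ever enters view $v+1$. 3. Suppose some honest replica enters view $v$. Then the leader of view $v$ is replaced through a view-change, i.e. every honest replica eventually enters view $v+1$, in each of the following cases: - (equivocation) there are two valid equivocating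 proposals of view $v$, signed by its leader, each of which is received by some (not necessarily the same) honest replica; - (stalling) every honest replica that enters view $v$ has, for some $p\ge 1$, committed fewer than $p$ new blocks in view $v$ within time $6\Delta+(p-1)\alpha$ after entering it; in particular, this covers the case that only finitely many valid proposals of view $v$ are ever received by honest replicas. -/

import Mathlib

namespace DeltaSMR

/-- The `n = 2 f + 1` replicas. -/
abbrev Replica (f : ℕ) : Type := Fin (2 * f + 1)

/-- Round-robin leader of view `v`. -/
def leader (f v : ℕ) : Replica f := ⟨v % (2 * f + 1), Nat.mod_lt _ (Nat.succ_pos _)⟩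

/-- A block `B_k = (b_k, H(B_{k-1}))` under a collision-free hash: it is identified with the list of
the batches on its hash chain, its own batch first.  `[]` is the genesis block, the height is the
length, and `B` extends `A` iff `A <:+ B`.  Holding a block does not mean holding its ancestors
(see `Execution.HasBlock`). -/
abbrev Block (β : Type*) : Type _ := List β

/-- Two blocks are equivocating if they are not equal and neither extends the other. -/
def EquivocatingBlocks {β : Type*} (A B : Block β) : Prop := ¬ A <:+ B ∧ ¬ B <:+ A

/-- A certificate `C_v(B)`: the votes of the replicas in `signers` for `block` in view `view`. -/
structure Cert (f : ℕ) (β : Type*) where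
  block : Block β
  view : ℕ
  signers : Finset (Replica f)

/-- The genesis block counts as certified (in the fictitious view `0`; actual views are `≥ 1`). -/
def genesisCert (f : ℕ) (β : Type*) : Cert f β := ⟨[], 0, ∅⟩

/-- A certificate has `f + 1` distinct signers. -/
def Cert.Valid {f : ℕ} {β : Type*} (C : Cert f β) : Prop :=
  C = genesisCert f β ∨ (1 ≤ C.view ∧ C.signers.card = f + 1)

/-- Ranking of certified blocks: first by view, then by height. -/
def Cert.RankLE {f : ℕ} {β : Type*} (C D : Cert f β) : Prop :=
  C.view < D.view ∨ (C.view = D.view ∧ C.block.length ≤ D.block.length)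

/-- `C` is a highest-ranked certificate of the collection `K`. -/
def IsHighest {f : ℕ} {β : Type*} (K : Set (Cert f β)) (C : Cert f β) : Prop :=
  C ∈ K ∧ ∀ D ∈ K, D.RankLE C

/-- The signed message `⟨status, B, C(B), v⟩_signer`, sent upon entering view `v + 1`. -/
structure Status (f : ℕ) (β : Type*) where
  signer : Replica f
  cert : Cert f β
  view : ℕ

def Status.Valid {f : ℕ} {β : Type*} (σ : Status f β) : Prop :=
  σ.cert.Valid ∧ σ.cert.view ≤ σ.view

/-- The message `⟨propose, B, S, v⟩_L`, signed by the leader `L` of view `v`; `none` is `S = ⊥`. -/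
structure Proposal (f : ℕ) (β : Type*) where
  block : Block β
  statuses : Option (Finset (Status f β))
  view : ℕ

/-- Well-formed proposals: an acceptable block, and `S` is `⊥` or consists of `f + 1` well-formed
`status` messages of distinct signers for the change into this view. -/
def Proposal.Valid {f : ℕ} {β : Type*} (valid : Block β → Prop) (P : Proposal f β) : Prop :=
  1 ≤ P.view ∧ P.block ≠ [] ∧ valid P.block ∧
    ∀ S, P.statuses = some S →
      S.card = f + 1 ∧ (∀ σ ∈ S, ∀ τ ∈ S, σ.signer = τ.signer → σ = τ) ∧
      ∀ σ ∈ S, σ.Valid ∧ σ.view + 1 = P.view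

/-- Equivocating proposals of one view: equivocating blocks, or two proposals with `S ≠ ⊥`. -/
def Proposal.Equivocates {f : ℕ} {β : Type*} (P Q : Proposal f β) : Prop :=
  P.view = Q.view ∧
    (EquivocatingBlocks P.block Q.block ∨ (P ≠ Q ∧ P.statuses ≠ none ∧ Q.statuses ≠ none))

/-- What replicas send.  All items but `block` are signed, a proposal by the leader of its view.
A quorum certificate is broadcast by sending the `f + 1` signed items it consists of. -/
inductive Item (f : ℕ) (β : Type*) where
  | propose (P : Proposal f β)
  | vote (i : Replica f) (B : Block β) (v : ℕ)
  | blame (i : Replica f) (v : ℕ)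
  | status (σ : Status f β)
  | block (B : Block β)

def Item.signer {f : ℕ} {β : Type*} : Item f β → Option (Replica f)
  | .propose P => some (leader f P.view)
  | .vote i _ _ => some i
  | .blame i _ => some i
  | .status σ => some σ.signer
  | .block _ => none

/-- The signed votes that a certificate consists of. -/
def Cert.votes {f : ℕ} {β : Type*} (C : Cert f β) : Set (Item f β) :=
  {y | ∃ j ∈ C.signers, y = .vote j C.block C.view}

/-- All items contained in an item, including itself. -/
def Item.parts {f : ℕ} {β : Type*} : Item f β → Set (Item f β)
  | .status σ => {.status σ} ∪ σ.cert.votes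
  | .propose P => {.propose P} ∪
      {y | ∃ S, P.statuses = some S ∧ ∃ σ ∈ S, y = .status σ ∨ y ∈ σ.cert.votes}
  | x => {x}

/-- The data of an execution in real time: the delay bound `Δ`, the proposal period `α`, the
application's validity rule for blocks, the set of honest replicas, the times at which replicas
start, the sending events (`sends i j x t`: replica `i` sends `x` to `j` at time `t`), and the time
of first arrival of each item at each replica (`⊤` if it never arrives). -/
structure Execution (f : ℕ) (β : Type*) where
  Δ : ℝ
  α : ℝ
  valid : Block β → Prop
  honest : Finset (Replica f)
  start : Replica f → ℝ
  sends : Replica f → Replica f → Item f β → ℝ → Prop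
  arrival : Replica f → Item f β → WithTop ℝ

namespace Execution

variable {f : ℕ} {β : Type*} (E : Execution f β)

/-- Replica `i` has received `x` by time `t` (inclusive). -/
def Knows (i : Replica f) (x : Item f β) (t : ℝ) : Prop := E.arrival i x ≤ (t : WithTop ℝ)

/-- Replica `i` sends `x` to all replicas at time `t`. -/
def Broadcast (i : Replica f) (x : Item f β) (t : ℝ) : Prop := ∀ j, E.sends i j x t

/-- Replica `i` has broadcast `x` at some time up to `t`. -/
def BroadcastBy (i : Replica f) (x : Item f β) (t : ℝ) : Prop := ∃ s ≤ t, E.Broadcast i x s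

/-- By time `t`, replica `i` has received votes of `f + 1` distinct replicas for `B` in view `v`. -/
def HasVotes (i : Replica f) (B : Block β) (v : ℕ) (t : ℝ) : Prop :=
  ∃ Q : Finset (Replica f), Q.card = f + 1 ∧ ∀ j ∈ Q, E.Knows i (.vote j B v) t

/-- By time `t`, replica `i` has received a blame certificate of view `v`. -/
def HasBlameCert (i : Replica f) (v : ℕ) (t : ℝ) : Prop :=
  ∃ Q : Finset (Replica f), Q.card = f + 1 ∧ ∀ j ∈ Q, E.Knows i (.blame j v) t

/-- By time `t`, replica `i` has entered view `v`.  View `1` is entered at the start; a replica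
enters view `v + 1` a time `2Δ` after it is in view `v` with a blame certificate of view `v`. -/
def EnteredBy (i : Replica f) : ℕ → ℝ → Prop
  | 0, _ => False
  | 1, t => E.start i ≤ t
  | v + 2, t => EnteredBy i (v + 1) (t - 2 * E.Δ) ∧ E.HasBlameCert i (v + 1) (t - 2 * E.Δ)

/-- `e` is the time at which replica `i` enters view `v`. -/
def EntersAt (i : Replica f) (v : ℕ) (e : ℝ) : Prop :=
  E.EnteredBy i v e ∧ ∀ s < e, ¬ E.EnteredBy i v s

/-- Replica `i` executes the steps of view `v` at time `t`: it has entered the view and no blame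
certificate of the view arrived earlier.  (A step that is due at the very instant at which the
certificate is completed, e.g. by the replica's own blame, is still taken.) -/
def Active (i : Replica f) (v : ℕ) (t : ℝ) : Prop :=
  E.EnteredBy i v t ∧ ∀ s < t, ¬ E.HasBlameCert i v s

/-- By time `t`, replica `i` has received equivocating blocks/proposals of the leader of view `v`. -/
def EquivKnown (i : Replica f) (v : ℕ) (t : ℝ) : Prop :=
  ∃ P Q : Proposal f β, P.Valid E.valid ∧ Q.Valid E.valid ∧ P.view = v ∧ Q.view = v ∧
    P.Equivocates Q ∧ E.Knows i (.propose P) t ∧ E.Knows i (.propose Q) t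

/-- Replica `i` holds the block `B`: it received it on its own or inside a proposal. -/
def HasBlock (i : Replica f) (B : Block β) (t : ℝ) : Prop :=
  B = [] ∨ E.Knows i (.block B) t ∨ ∃ P : Proposal f β, P.block = B ∧ E.Knows i (.propose P) t

/-- The chain that `B` extends is known to replica `i`. -/
def KnownChain (i : Replica f) (B : Block β) (t : ℝ) : Prop :=
  ∀ A, A <:+ B → A ≠ B → E.HasBlock i A t

/-- At time `t`, replica `i` knows the certificate `C`: it is that of genesis, or its votes were
received not later than `i` entered the next view (later ones are ignored), or it was contained in
the set `S` of a valid proposal of a view that `i` has entered, received in the same way. -/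
def KnownCert (i : Replica f) (C : Cert f β) (t : ℝ) : Prop :=
  C = genesisCert f β ∨
  (1 ≤ C.view ∧ C.signers.card = f + 1 ∧
    ∃ r ≤ t, (∀ s < r, ¬ E.EnteredBy i (C.view + 1) s) ∧
      ∀ j ∈ C.signers, E.Knows i (.vote j C.block C.view) r) ∨
  (∃ (P : Proposal f β) (S : Finset (Status f β)), P.Valid E.valid ∧ P.statuses = some S ∧
    (∃ σ ∈ S, σ.cert = C) ∧ E.EnteredBy i P.view t ∧
    ∃ r ≤ t, (∀ s < r, ¬ E.EnteredBy i (P.view + 1) s) ∧ E.Knows i (.propose P) r)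

/-- The condition under which replica `i` starts the vote-timer of the proposal `P`. -/
def TimerCond (i : Replica f) (P : Proposal f β) (t : ℝ) : Prop :=
  P.Valid E.valid ∧ E.Active i P.view t ∧ E.Knows i (.propose P) t ∧ E.KnownChain i P.block t ∧
  ((∃ S C, P.statuses = some S ∧ IsHighest {D | ∃ σ ∈ S, σ.cert = D} C ∧ C.block <:+ P.block) ∨
   (P.statuses = none ∧ ∃ C, IsHighest {D | E.KnownCert i D t} C ∧ C.block <:+ P.block))

/-- `τ` is the time at which replica `i` starts the vote-timer of `P`. -/
def StartsTimer (i : Replica f) (P : Proposal f β) (τ : ℝ) : Prop :=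
  E.TimerCond i P τ ∧ ∀ s < τ, ¬ E.TimerCond i P s

/-- The vote-timer of `P` at replica `i` reaches `0` at time `t`, and `i` votes for `P`. -/
def Votes (i : Replica f) (P : Proposal f β) (t : ℝ) : Prop :=
  E.StartsTimer i P (t - E.Δ) ∧ E.Active i P.view t ∧ ¬ E.EquivKnown i P.view t

/-- The condition for replica `i` to commit `B` directly in view `v` holds at time `t`. -/
def DirectCommit (i : Replica f) (v : ℕ) (B : Block β) (t : ℝ) : Prop :=
  E.Active i v t ∧ ¬ E.EquivKnown i v t ∧ E.HasVotes i B v t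

/-- By time `t`, replica `i` has committed the (non-genesis) block `B`, directly or as an ancestor,
by a commit step of view `v`. -/
def CommittedIn (i : Replica f) (v : ℕ) (B : Block β) (t : ℝ) : Prop :=
  B ≠ [] ∧ ∃ B', B <:+ B' ∧ ∃ s ≤ t, E.DirectCommit i v B' s

/-- By time `t`, replica `i` has committed `B`. -/
def Committed (i : Replica f) (B : Block β) (t : ℝ) : Prop := ∃ v, E.CommittedIn i v B t

/-- The new blocks that replica `i` has committed in view `v` by time `t`: those that it had not
committed in an earlier view. -/
def newBlocks (i : Replica f) (v : ℕ) (t : ℝ) : Set (Block β) :=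
  {B | E.CommittedIn i v B t ∧ ∀ u < v, ∀ s, ¬ E.CommittedIn i u B s}

/-- `6Δ + (p - 1)α`, the time allowed for `p` commits. -/
noncomputable def allowance (p : ℕ) : ℝ := 6 * E.Δ + ((p : ℝ) - 1) * E.α

/-- For some `p ≥ 1` whose deadline is not after `t`, replica `i` committed fewer than `p` new blocks
within the allowance for `p` since it entered view `v`. -/
def Late (i : Replica f) (v : ℕ) (t : ℝ) : Prop :=
  ∃ (e : ℝ) (p : ℕ), E.EntersAt i v e ∧ 1 ≤ p ∧ e + E.allowance p ≤ t ∧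
    (E.newBlocks i v (e + E.allowance p)).encard < p

/-- The time of the first proposal of a leader that entered view `v` at time `e`: it waits `2Δ` for
`status` messages after a view-change. -/
noncomputable def firstProposalTime (v : ℕ) (e : ℝ) : ℝ := if v = 1 then e else e + 2 * E.Δ

/-- `P` is a possible first proposal of the honest leader of view `v` at time `t`: in view `1` a
child of genesis with `S = ⊥`; after a view-change, `S` consists of received `status` messages, among
them one with the highest certified block of all received ones, and the block is a child of it. -/
def FirstProposal (v : ℕ) (t : ℝ) (P : Proposal f β) : Prop :=
  P.Valid E.valid ∧ P.view = v ∧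
  ((v = 1 ∧ P.statuses = none ∧ ∃ b, P.block = [b]) ∨
   (v ≠ 1 ∧ ∃ S C b, P.statuses = some S ∧ (∀ σ ∈ S, E.Knows (leader f v) (.status σ) t) ∧
      (∃ σ ∈ S, σ.cert = C) ∧
      IsHighest {D | ∃ σ : Status f β, σ.Valid ∧ σ.view + 1 = v ∧
        E.Knows (leader f v) (.status σ) t ∧ σ.cert = D} C ∧
      P.block = b :: C.block))

/-- The honest leader of view `v`, able to propose from time `T` on, proposes a block every `α` time
(at `T, T + α, T + 2α, …` while it is active), the later ones with `S = ⊥` and each a child of the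
previous one, and signs no other proposals of this view.  It proposes nothing if it has not received
enough `status` messages to form a first proposal. -/
def ProposesFrom (v : ℕ) (T : ℝ) : Prop :=
  (∃ P : ℕ → Proposal f β, E.FirstProposal v T (P 0) ∧
    (∀ k, (P (k + 1)).Valid E.valid ∧ (P (k + 1)).view = v ∧ (P (k + 1)).statuses = none ∧
      ∃ b, (P (k + 1)).block = b :: (P k).block) ∧
    (∀ k : ℕ, E.Active (leader f v) v (T + k * E.α) →
      E.Broadcast (leader f v) (.propose (P k)) (T + k * E.α)) ∧
    (∀ Q j s, E.sends (leader f v) j (.propose Q) s → Q.view = v →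
      ∃ k : ℕ, Q = P k ∧ T + k * E.α ≤ s ∧ E.Active (leader f v) v (T + k * E.α))) ∨
  ((¬ ∃ P, E.FirstProposal v T P) ∧
    ∀ Q j s, E.sends (leader f v) j (.propose Q) s → Q.view ≠ v)

/-- The network and adversary: at most `f` of the `2 f + 1` replicas are Byzantine, and they may send
anything at any time except forged signatures of honest replicas. -/
structure IsSynchronous : Prop where
  honest_card : f + 1 ≤ E.honest.card
  /-- The clock skew is at most `Δ`. -/
  start_skew : ∀ i ∈ E.honest, ∀ j ∈ E.honest, E.start i ≤ E.start j + E.Δ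
  /-- Only finitely many items arrive in a bounded time. -/
  finite_arrivals : ∀ i ∈ E.honest, ∀ t, {x | E.Knows i x t}.Finite
  delivery : ∀ i ∈ E.honest, ∀ j ∈ E.honest, ∀ x t, E.sends i j x t → E.Knows j x (t + E.Δ)
  /-- A replica has what it sends to itself at once. -/
  self_delivery : ∀ i ∈ E.honest, ∀ x t, E.sends i i x t → E.Knows i x t
  /-- Whatever an honest replica `i` is seen to have signed, it has signed and sent before. -/
  unforgeable : ∀ i ∈ E.honest, ∀ j ∈ E.honest, ∀ x t, E.Knows j x t →
    ∀ y ∈ x.parts, y.signer = some i → ∃ k, ∃ s ≤ t, E.sends i k y s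

/-- Every honest replica follows the protocol.  For each step, the first rule says that the step is
taken, and the rule named `…_only` that items of this kind are signed in no other way (signed items
may be sent again later, as parts of certificates). -/
structure FollowsProtocol : Prop where
  /-- Propose. -/
  propose : ∀ v e, leader f v ∈ E.honest → E.EntersAt (leader f v) v e →
    E.ProposesFrom v (E.firstProposalTime v e)
  propose_only : ∀ (P : Proposal f β) j s, leader f P.view ∈ E.honest →
    E.sends (leader f P.view) j (.propose P) s → ∃ e, E.EntersAt (leader f P.view) P.view e
  /-- Forward a valid proposal upon receiving it. -/
  forward : ∀ i ∈ E.honest, ∀ (P : Proposal f β) t, P.Valid E.valid → E.Active i P.view t →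
    E.Knows i (.propose P) t → E.BroadcastBy i (.propose P) t
  /-- When the vote-timer is started, the blocks of the chain that have not been forwarded are. -/
  forward_chain : ∀ i ∈ E.honest, ∀ (P : Proposal f β) τ, E.StartsTimer i P τ →
    ∀ A, A <:+ P.block → A ≠ P.block → A ≠ [] →
      E.BroadcastBy i (.block A) τ ∨
        ∃ P' : Proposal f β, P'.block = A ∧ E.BroadcastBy i (.propose P') τ
  /-- Vote. -/
  vote : ∀ i ∈ E.honest, ∀ (P : Proposal f β) t, E.Votes i P t →
    E.Broadcast i (.vote i P.block P.view) t
  vote_only : ∀ i ∈ E.honest, ∀ B v j s, E.sends i j (.vote i B v) s →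
    ∃ P : Proposal f β, P.block = B ∧ P.view = v ∧ ∃ t ≤ s, E.Votes i P t
  /-- Commit: broadcast the vote certificate of a directly committed block. -/
  commit : ∀ i ∈ E.honest, ∀ v B t, E.DirectCommit i v B t →
    ∃ Q : Finset (Replica f), Q.card = f + 1 ∧
      ∀ j ∈ Q, E.Knows i (.vote j B v) t ∧ E.BroadcastBy i (.vote j B v) t
  /-- Blame. -/
  blame : ∀ i ∈ E.honest, ∀ v t, E.Active i v t → (E.Late i v t ∨ E.EquivKnown i v t) →
    E.BroadcastBy i (.blame i v) t
  blame_evidence : ∀ i ∈ E.honest, ∀ v t, E.Active i v t → E.EquivKnown i v t →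
    ∃ P Q : Proposal f β, P.Valid E.valid ∧ Q.Valid E.valid ∧ P.view = v ∧ Q.view = v ∧
      P.Equivocates Q ∧ E.BroadcastBy i (.propose P) t ∧ E.BroadcastBy i (.propose Q) t
  blame_only : ∀ i ∈ E.honest, ∀ v j s, E.sends i j (.blame i v) s →
    ∃ t ≤ s, E.Active i v t ∧ (E.Late i v t ∨ E.EquivKnown i v t)
  /-- New-view: broadcast the blame certificate. -/
  blame_cert : ∀ i ∈ E.honest, ∀ v t, E.EnteredBy i v t → E.HasBlameCert i v t →
    ∃ Q : Finset (Replica f), Q.card = f + 1 ∧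
      ∀ j ∈ Q, E.Knows i (.blame j v) t ∧ E.BroadcastBy i (.blame j v) t
  /-- New-view: upon entering view `v + 1`, send the highest certified block to its leader. -/
  status : ∀ i ∈ E.honest, ∀ v e, 1 ≤ v → E.EntersAt i (v + 1) e →
    ∃ C, IsHighest {D | E.KnownCert i D e ∧ D.view ≤ v} C ∧
      E.sends i (leader f (v + 1)) (.status ⟨i, C, v⟩) e
  status_only : ∀ i ∈ E.honest, ∀ (σ : Status f β) j s, σ.signer = i →
    E.sends i j (.status σ) s → 1 ≤ σ.view ∧ ∃ e ≤ s, E.EntersAt i (σ.view + 1) e ∧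
      IsHighest {D | E.KnownCert i D e ∧ D.view ≤ σ.view} σ.cert

/-- Some honest replica gets to view `v`. -/
def Reached (v : ℕ) : Prop := ∃ i ∈ E.honest, ∃ t, E.EnteredBy i v t

/-- The leader of view `v` is replaced: every honest replica moves on to view `v + 1`. -/
def Replaced (v : ℕ) : Prop := ∀ i ∈ E.honest, ∃ t, E.EnteredBy i (v + 1) t

/-- The proposal `P` is received by some honest replica. -/
def ReachesHonest (P : Proposal f β) : Prop := ∃ i ∈ E.honest, ∃ t, E.Knows i (.propose P) t

end Execution

end DeltaSMR

/-! The argument rests on timing rather than on quorum intersection: two quorums of `f + 1` replicas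
may share only a Byzantine one, but each contains an honest one.

Safety. A voter has forwarded its proposal at least `Δ` before voting, so equivocating blocks never
both get honest votes in one view (`HonestVote.comparable`). A replica that commits `B` in view `u`
broadcasts its certificate, and the `2Δ` wait of a view-change lets it arrive everywhere before
anyone enters view `u + 1`. Hence honest votes of later views extend `B`
(`DirectCommit.suffix_of_votes`).

Honest leader. Its `2Δ` wait collects the status of every honest replica, so its parent block ranks
at least as high as any certificate of an earlier view that honest replicas still use
(`KnownCert.rankLE_parent`). Each proposal is therefore committed within `3Δ`
(`Schedule.directCommit`), and by safety it is a new block. The first one is made at most `3Δ` after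
any honest replica enters, which gives `6Δ`. Commits and the absence of blames depend on each other;
strong induction on the index of the proposal resolves this (`Schedule.noBlameBefore`).

Progress. The honest replicas alone can replace a leader (`reached_succ_of_blame`). Views cannot
pass an honest leader, so there is a last view (`exists_last_view`), whose leader may still be
Byzantine. As that leader is not replaced, some honest replica is never late and commits arbitrarily
many blocks; its certificates make all others commit them too (`CommittedIn.of_last_view`). -/

namespace DeltaSMR

namespace Execution

variable {f : ℕ} {β : Type*} {E : Execution f β}

/-! ### Monotonicity in time and entry times of views -/

/-- A condition that can begin to hold only at finitely many times has a first time. -/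
theorem exists_first {Φ : ℝ → Prop} {t : ℝ} {F : Set ℝ} (hF : F.Finite)
    (h : ∀ s ≤ t, Φ s → ∃ a ∈ F, a ≤ s ∧ Φ a) (ht : Φ t) :
    ∃ τ ≤ t, Φ τ ∧ ∀ s < τ, ¬ Φ s := by
  obtain ⟨a, haF, hat, ha⟩ := h t le_rfl ht
  have hfin : {a ∈ F | a ≤ t ∧ Φ a}.Finite := hF.subset fun _ hx => hx.1
  obtain ⟨τ, ⟨-, hτt, hτ⟩, hmin⟩ :=
    Set.exists_min_image _ id hfin ⟨a, haF, hat, ha⟩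
  refine ⟨τ, hτt, hτ, fun s hs hΦ => ?_⟩
  obtain ⟨b, hbF, hbs, hb⟩ := h s (hs.le.trans hτt) hΦ
  have : τ ≤ b := hmin b ⟨hbF, by linarith, hb⟩
  linarith

theorem Knows.mono {i : Replica f} {x : Item f β} {s t : ℝ} (h : E.Knows i x s) (hst : s ≤ t) :
    E.Knows i x t :=
  le_trans h (WithTop.coe_le_coe.2 hst)

theorem HasBlameCert.mono {i : Replica f} {v : ℕ} {s t : ℝ} (h : E.HasBlameCert i v s)
    (hst : s ≤ t) : E.HasBlameCert i v t := by
  obtain ⟨Q, hQ, h⟩ := h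
  exact ⟨Q, hQ, fun j hj => (h j hj).mono hst⟩

theorem EquivKnown.mono {i : Replica f} {v : ℕ} {s t : ℝ} (h : E.EquivKnown i v s)
    (hst : s ≤ t) : E.EquivKnown i v t := by
  obtain ⟨P, Q, hP, hQ, hPv, hQv, hPQ, h₁, h₂⟩ := h
  exact ⟨P, Q, hP, hQ, hPv, hQv, hPQ, h₁.mono hst, h₂.mono hst⟩

theorem HasBlock.mono {i : Replica f} {B : Block β} {s t : ℝ} (h : E.HasBlock i B s)
    (hst : s ≤ t) : E.HasBlock i B t := by
  obtain h | h | ⟨P, hP, h⟩ := h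
  · exact .inl h
  · exact .inr (.inl (h.mono hst))
  · exact .inr (.inr ⟨P, hP, h.mono hst⟩)

theorem CommittedIn.mono {i : Replica f} {v : ℕ} {B : Block β} {s t : ℝ}
    (h : E.CommittedIn i v B s) (hst : s ≤ t) : E.CommittedIn i v B t := by
  obtain ⟨hB, B', hB', r, hr, h⟩ := h
  exact ⟨hB, B', hB', r, hr.trans hst, h⟩

theorem enteredBy_succ {i : Replica f} {v : ℕ} (hv : 1 ≤ v) {t : ℝ} :
    E.EnteredBy i (v + 1) t ↔
      E.EnteredBy i v (t - 2 * E.Δ) ∧ E.HasBlameCert i v (t - 2 * E.Δ) := by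
  obtain ⟨v, rfl⟩ := Nat.exists_eq_add_of_le' hv
  rfl

theorem EnteredBy.one_le {i : Replica f} {v : ℕ} {t : ℝ} (h : E.EnteredBy i v t) : 1 ≤ v := by
  cases v with
  | zero => exact h.elim
  | succ v => omega

theorem EnteredBy.mono {i : Replica f} {v : ℕ} {s t : ℝ} (h : E.EnteredBy i v s)
    (hst : s ≤ t) : E.EnteredBy i v t := by
  induction v generalizing s t with
  | zero => exact h
  | succ v ih =>
    rcases Nat.eq_zero_or_pos v with rfl | hv
    · exact le_trans h hst
    · rw [enteredBy_succ hv] at h ⊢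
      exact ⟨ih h.1 (by linarith), h.2.mono (by linarith)⟩

/-- A replica that has entered a later view has had a blame certificate for `2Δ`. -/
theorem EnteredBy.of_lt (hΔ : 0 < E.Δ) {i : Replica f} {u w : ℕ} {t : ℝ}
    (h : E.EnteredBy i w t) (hu : 1 ≤ u) (huw : u < w) :
    E.EnteredBy i u (t - 2 * E.Δ) ∧ E.HasBlameCert i u (t - 2 * E.Δ) := by
  induction w, huw using Nat.le_induction generalizing t with
  | base => exact (enteredBy_succ hu).1 h
  | succ w hw ih =>
    have h' := (enteredBy_succ (by omega)).1 h
    exact ih (h'.1.mono (by linarith))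

theorem EnteredBy.of_le (hΔ : 0 < E.Δ) {i : Replica f} {u w : ℕ} {t : ℝ}
    (h : E.EnteredBy i w t) (hu : 1 ≤ u) (huw : u ≤ w) : E.EnteredBy i u t := by
  rcases huw.eq_or_lt with rfl | hlt
  · exact h
  · exact (h.of_lt hΔ hu hlt).1.mono (by linarith)

theorem HasBlameCert.exists_first {i : Replica f} {v : ℕ} {t : ℝ} (h : E.HasBlameCert i v t) :
    ∃ τ ≤ t, E.HasBlameCert i v τ ∧ ∀ s < τ, ¬ E.HasBlameCert i v s := by
  -- The default `0` for blames that never arrive only adds a harmless candidate time.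
  have hF : (Set.range fun j => (E.arrival i (.blame j v)).untopD 0).Finite := Set.finite_range _
  refine Execution.exists_first hF (fun s _ hs => ?_) h
  obtain ⟨Q, hQ, hs⟩ := hs
  obtain ⟨j, hj, hmax⟩ := Q.exists_max_image (fun j => E.arrival i (.blame j v))
    (Finset.card_pos.1 (by omega))
  have hjs : E.arrival i (.blame j v) ≤ (s : WithTop ℝ) := hs j hj
  obtain ⟨a, ha⟩ := WithTop.ne_top_iff_exists.1 (ne_top_of_le_ne_top WithTop.coe_ne_top hjs)
  refine ⟨a, ⟨j, by simp [← ha]⟩, ?_, Q, hQ, fun k hk => ?_⟩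
  · rw [← ha] at hjs
    exact WithTop.coe_le_coe.1 hjs
  · exact (hmax k hk).trans ha.symm.le

theorem EnteredBy.exists_entersAt {i : Replica f} {v : ℕ} {t : ℝ} (h : E.EnteredBy i v t) :
    ∃ e ≤ t, E.EntersAt i v e := by
  induction v generalizing t with
  | zero => exact h.elim
  | succ v ih =>
    rcases Nat.eq_zero_or_pos v with rfl | hv
    · exact ⟨E.start i, h, le_refl (E.start i), fun s hs => not_le.2 hs⟩
    · rw [enteredBy_succ hv] at h
      obtain ⟨e, he, hee, hen⟩ := ih h.1
      obtain ⟨b, hb, hbb, hbn⟩ := h.2.exists_first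
      refine ⟨max e b + 2 * E.Δ, by linarith [max_le he hb], ?_, fun s hs => ?_⟩
      · rw [enteredBy_succ hv]
        exact ⟨hee.mono (by linarith [le_max_left e b]), hbb.mono (by linarith [le_max_right e b])⟩
      · rw [enteredBy_succ hv]
        rintro ⟨h₁, h₂⟩
        have h₃ : e ≤ s - 2 * E.Δ := not_lt.1 fun h => hen _ h h₁
        have h₄ : b ≤ s - 2 * E.Δ := not_lt.1 fun h => hbn _ h h₂
        linarith [max_le h₃ h₄]

theorem EntersAt.le {i : Replica f} {v : ℕ} {e t : ℝ} (h : E.EntersAt i v e)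
    (ht : E.EnteredBy i v t) : e ≤ t :=
  not_lt.1 fun hlt => h.2 t hlt ht

theorem EntersAt.unique {i : Replica f} {v : ℕ} {e e' : ℝ} (h : E.EntersAt i v e)
    (h' : E.EntersAt i v e') : e = e' :=
  le_antisymm (h.le h'.1) (h'.le h.1)

/-! ### Quorums and synchronization of views -/

theorem BroadcastBy.knows (hsync : E.IsSynchronous) {i j : Replica f} (hi : i ∈ E.honest)
    (hj : j ∈ E.honest) {x : Item f β} {t : ℝ} (h : E.BroadcastBy i x t) :
    E.Knows j x (t + E.Δ) := by
  obtain ⟨s, hs, h⟩ := h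
  exact (hsync.delivery i hi j hj x s (h j)).mono (by linarith)

theorem exists_honest_of_card (hsync : E.IsSynchronous) {Q : Finset (Replica f)}
    (hQ : Q.card = f + 1) : ∃ h ∈ Q, h ∈ E.honest := by
  by_contra! hcon
  have hdisj : Disjoint Q E.honest := Finset.disjoint_left.2 hcon
  have h₁ := Finset.card_le_univ (Q ∪ E.honest)
  rw [Finset.card_union_of_disjoint hdisj, Fintype.card_fin] at h₁
  have := hsync.honest_card
  omega

theorem exists_honest (hsync : E.IsSynchronous) : ∃ i, i ∈ E.honest :=
  Finset.card_pos.1 (by have := hsync.honest_card; omega)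

theorem HasBlameCert.forward (hsync : E.IsSynchronous) (hprot : E.FollowsProtocol)
    {i j : Replica f} (hi : i ∈ E.honest) (hj : j ∈ E.honest) {v : ℕ} {t : ℝ}
    (he : E.EnteredBy i v t) (h : E.HasBlameCert i v t) : E.HasBlameCert j v (t + E.Δ) := by
  obtain ⟨Q, hQ, hb⟩ := hprot.blame_cert i hi v t he h
  exact ⟨Q, hQ, fun k hk => (hb k hk).2.knows hsync hi hj⟩

/-- Honest replicas enter each view at most `Δ` apart. -/
theorem EnteredBy.skew (hsync : E.IsSynchronous) (hprot : E.FollowsProtocol)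
    {i j : Replica f} (hi : i ∈ E.honest) (hj : j ∈ E.honest) {v : ℕ} {t : ℝ}
    (h : E.EnteredBy i v t) : E.EnteredBy j v (t + E.Δ) := by
  induction v generalizing t with
  | zero => exact h
  | succ v ih =>
    rcases Nat.eq_zero_or_pos v with rfl | hv
    · have h₁ : E.start i ≤ t := h
      have h₂ := hsync.start_skew j hj i hi
      exact (show E.start j ≤ t + E.Δ by linarith)
    · rw [enteredBy_succ hv] at h ⊢
      have h₂ := h.2.forward hsync hprot hi hj h.1
      exact ⟨(ih h.1).mono (by linarith), h₂.mono (by linarith)⟩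

theorem EntersAt.skew (hsync : E.IsSynchronous) (hprot : E.FollowsProtocol)
    {i j : Replica f} (hi : i ∈ E.honest) (hj : j ∈ E.honest) {v : ℕ} {e e' : ℝ}
    (h : E.EntersAt i v e) (h' : E.EntersAt j v e') : e' ≤ e + E.Δ :=
  h'.le (h.1.skew hsync hprot hi hj)

/-! ### Honest votes behind certificates -/

theorem Item.mem_parts_self (x : Item f β) : x ∈ x.parts := by
  cases x <;> simp [Item.parts]

/-- By time `t`, some honest replica has cast a vote for `B` in view `v`. -/
def HonestVote (E : Execution f β) (B : Block β) (v : ℕ) (t : ℝ) : Prop :=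
  ∃ h ∈ E.honest, ∃ P : Proposal f β, P.block = B ∧ P.view = v ∧ ∃ s ≤ t, E.Votes h P s

theorem HonestVote.mono {B : Block β} {v : ℕ} {s t : ℝ} (h : E.HonestVote B v s) (hst : s ≤ t) :
    E.HonestVote B v t := by
  obtain ⟨h, hh, P, hB, hv, r, hr, hV⟩ := h
  exact ⟨h, hh, P, hB, hv, r, hr.trans hst, hV⟩

/-- Passing to `x.parts` covers certificates carried inside `status` messages and proposals as well
as votes received on their own. -/
theorem honestVote_of_quorum (hsync : E.IsSynchronous) (hprot : E.FollowsProtocol)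
    {i : Replica f} (hi : i ∈ E.honest) {Q : Finset (Replica f)} (hQ : Q.card = f + 1)
    {B : Block β} {v : ℕ} {t : ℝ}
    (h : ∀ j ∈ Q, ∃ x, E.Knows i x t ∧ .vote j B v ∈ x.parts) : E.HonestVote B v t := by
  obtain ⟨j, hjQ, hj⟩ := exists_honest_of_card hsync hQ
  obtain ⟨x, hx, hxj⟩ := h j hjQ
  obtain ⟨k, s, hs, hsend⟩ := hsync.unforgeable j hj i hi x t hx _ hxj rfl
  obtain ⟨P, hPB, hPv, r, hr, hV⟩ := hprot.vote_only j hj B v k s hsend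
  exact ⟨j, hj, P, hPB, hPv, r, hr.trans hs, hV⟩

theorem HasVotes.honestVote (hsync : E.IsSynchronous) (hprot : E.FollowsProtocol)
    {i : Replica f} (hi : i ∈ E.honest) {B : Block β} {v : ℕ} {t : ℝ} (h : E.HasVotes i B v t) :
    E.HonestVote B v t := by
  obtain ⟨Q, hQ, h⟩ := h
  exact honestVote_of_quorum hsync hprot hi hQ fun j hj => ⟨_, h j hj, Item.mem_parts_self _⟩

theorem Votes.broadcastBy (hprot : E.FollowsProtocol) {h : Replica f} (hh : h ∈ E.honest)
    {P : Proposal f β} {t : ℝ} (hV : E.Votes h P t) :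
    E.BroadcastBy h (.propose P) (t - E.Δ) :=
  hprot.forward h hh P _ hV.1.1.1 hV.1.1.2.1 hV.1.1.2.2.1

/-- The timer lasts exactly the delay bound: what is forwarded by its start has arrived everywhere
by its end. -/
theorem Votes.knows (hsync : E.IsSynchronous) (hprot : E.FollowsProtocol) {h g : Replica f}
    (hh : h ∈ E.honest) (hg : g ∈ E.honest) {P : Proposal f β} {t : ℝ} (hV : E.Votes h P t) :
    E.Knows g (.propose P) t := by
  simpa using (hV.broadcastBy hprot hh).knows hsync hh hg

/-- The voted block and its ancestors are known to all honest replicas at the time of the vote. -/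
theorem Votes.hasBlock (hsync : E.IsSynchronous) (hprot : E.FollowsProtocol) {h g : Replica f}
    (hh : h ∈ E.honest) (hg : g ∈ E.honest) {P : Proposal f β} {t : ℝ} (hV : E.Votes h P t)
    {A : Block β} (hA : A <:+ P.block) : E.HasBlock g A t := by
  by_cases hAP : A = P.block
  · exact .inr (.inr ⟨P, hAP.symm, hV.knows hsync hprot hh hg⟩)
  by_cases hA0 : A = []
  · exact .inl hA0
  rcases hprot.forward_chain h hh P _ hV.1 A hA hAP hA0 with h₁ | ⟨P', hP', h₁⟩
  · exact .inr (.inl (by simpa using h₁.knows hsync hh hg))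
  · exact .inr (.inr ⟨P', hP', by simpa using h₁.knows hsync hh hg⟩)

/-- The earlier voter's proposal has reached the later voter by the time of the later vote, which a
detected equivocation would have prevented. -/
theorem Votes.comparable_of_le (hΔ : 0 < E.Δ) (hsync : E.IsSynchronous)
    (hprot : E.FollowsProtocol)
    {h g : Replica f} (hh : h ∈ E.honest) (hg : g ∈ E.honest) {P Q : Proposal f β} {s t : ℝ}
    (hP : E.Votes h P s) (hQ : E.Votes g Q t) (hst : s ≤ t) (hv : P.view = Q.view) :
    P.block <:+ Q.block ∨ Q.block <:+ P.block := by
  by_contra hcon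
  rw [not_or] at hcon
  exact hQ.2.2 ⟨P, Q, hP.1.1.1, hQ.1.1.1, hv, rfl, ⟨hv, .inl hcon⟩,
    (hP.knows hsync hprot hh hg).mono hst, hQ.1.1.2.2.1.mono (by linarith)⟩

/-- Honest replicas do not vote for equivocating blocks in one view. -/
theorem HonestVote.comparable (hΔ : 0 < E.Δ) (hsync : E.IsSynchronous)
    (hprot : E.FollowsProtocol) {A B : Block β} {v : ℕ} {s t : ℝ}
    (hA : E.HonestVote A v s) (hB : E.HonestVote B v t) : A <:+ B ∨ B <:+ A := by
  obtain ⟨h, hh, P, rfl, hPv, s, -, hP⟩ := hA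
  obtain ⟨g, hg, Q, rfl, hQv, t, -, hQ⟩ := hB
  rcases le_total s t with hst | hst
  · exact hP.comparable_of_le hΔ hsync hprot hh hg hQ hst (hPv.trans hQv.symm)
  · exact (hQ.comparable_of_le hΔ hsync hprot hg hh hP hst (hQv.trans hPv.symm)).symm

/-- `C` is the certificate of genesis, or contains a vote cast by an honest replica by time `t`. -/
def Backed (E : Execution f β) (C : Cert f β) (t : ℝ) : Prop :=
  C = genesisCert f β ∨ E.HonestVote C.block C.view t

theorem KnownCert.backed (hsync : E.IsSynchronous) (hprot : E.FollowsProtocol)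
    {i : Replica f} (hi : i ∈ E.honest) {C : Cert f β} {t : ℝ} (h : E.KnownCert i C t) :
    E.Backed C t := by
  rcases h with h | ⟨-, hcard, r, hr, -, h⟩ | ⟨P, S, hP, hS, ⟨σ, hσ, rfl⟩, -, r, hr, -, h⟩
  · exact .inl h
  · exact .inr ((honestVote_of_quorum hsync hprot hi hcard
      fun j hj => ⟨_, h j hj, Item.mem_parts_self _⟩).mono hr)
  · rcases ((hP.2.2.2 S hS).2.2 σ hσ).1.1 with hg | ⟨-, hcard⟩
    · exact .inl hg
    · refine .inr ((honestVote_of_quorum hsync hprot hi hcard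
        fun j hj => ⟨_, h, .inr ⟨S, hS, σ, hσ, .inr ⟨j, hj, rfl⟩⟩⟩).mono hr)

theorem KnownCert.valid {i : Replica f} {C : Cert f β} {t : ℝ} (h : E.KnownCert i C t) :
    C.Valid := by
  rcases h with h | ⟨hv, hcard, -⟩ | ⟨P, S, hP, hS, ⟨σ, hσ, rfl⟩, -⟩
  · exact .inl h
  · exact .inr ⟨hv, hcard⟩
  · exact ((hP.2.2.2 S hS).2.2 σ hσ).1.1

theorem backed_of_knows_status (hsync : E.IsSynchronous) (hprot : E.FollowsProtocol)
    {i : Replica f} (hi : i ∈ E.honest) {σ : Status f β} {t : ℝ} (hσ : σ.Valid)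
    (h : E.Knows i (.status σ) t) : E.Backed σ.cert t := by
  rcases hσ.1 with hg | ⟨-, hcard⟩
  · exact .inl hg
  · exact .inr (honestVote_of_quorum hsync hprot hi hcard
      fun j hj => ⟨_, h, .inr ⟨j, hj, rfl⟩⟩)

/-! ### Safety across views -/

theorem _root_.DeltaSMR.Cert.RankLE.trans {C D F : Cert f β} (h : C.RankLE D) (h' : D.RankLE F) :
    C.RankLE F := by
  unfold Cert.RankLE at *
  omega

/-- After a direct commit of view `u`, no honest replica enters view `u + 1` for a time `Δ`. -/
theorem DirectCommit.le_of_enteredBy (hsync : E.IsSynchronous)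
    (hprot : E.FollowsProtocol) {i j : Replica f} (hi : i ∈ E.honest) (hj : j ∈ E.honest)
    {u : ℕ} {B : Block β} {s t : ℝ} (hc : E.DirectCommit i u B s)
    (ht : E.EnteredBy j (u + 1) t) : s + E.Δ ≤ t := by
  have hu := hc.1.1.one_le
  rw [enteredBy_succ hu] at ht
  -- The blame certificate that `j` held at `t - 2Δ` is at `i` by `t - Δ`, and `i` commits nothing
  -- after that.
  have hb := ht.2.forward hsync hprot hj hi ht.1
  have := not_lt.1 fun hlt => hc.1.2 _ hlt hb
  linarith

/-- A block directly committed in view `u` has a certificate that all honest replicas know from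
the time on at which they leave the view. -/
theorem DirectCommit.exists_knownCert (hΔ : 0 < E.Δ) (hsync : E.IsSynchronous)
    (hprot : E.FollowsProtocol) {i : Replica f} (hi : i ∈ E.honest)
    {u : ℕ} {B : Block β} {s : ℝ} (hc : E.DirectCommit i u B s) :
    ∃ C : Cert f β, C.block = B ∧ C.view = u ∧
      ∀ j ∈ E.honest, ∀ w > u, ∀ t, E.EnteredBy j w t → E.KnownCert j C t := by
  have hu := hc.1.1.one_le
  obtain ⟨Q, hQ, hb⟩ := hprot.commit i hi u B s hc
  -- At `s + Δ` the votes broadcast by `i` have arrived; this is early enough not to be ignored,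
  -- since nobody has entered view `u + 1` before.
  refine ⟨⟨B, u, Q⟩, rfl, rfl, fun j hj w hw t ht => .inr (.inl ⟨hu, hQ, s + E.Δ, ?_, ?_, ?_⟩)⟩
  · exact hc.le_of_enteredBy hsync hprot hi hj (ht.of_le hΔ (by omega) hw)
  · intro r hr hen
    exact absurd (hc.le_of_enteredBy hsync hprot hi hj hen) (not_le.2 hr)
  · exact fun k hk => (hb k hk).2.knows hsync hi hj

/-- The certificate in a `status` message of an honest replica for the change into view `w` is
at least as high as every block directly committed in an earlier view. -/
theorem rankLE_of_status (hsync : E.IsSynchronous) (hprot : E.FollowsProtocol)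
    {j k : Replica f} (hj : j ∈ E.honest) (hk : k ∈ E.honest) {C : Cert f β} {u : ℕ}
    (hC : C.view = u)
    (hknown : ∀ j ∈ E.honest, ∀ w > u, ∀ t, E.EnteredBy j w t → E.KnownCert j C t)
    {σ : Status f β} (hσ : σ.signer = j) {x : Item f β} (hx : .status σ ∈ x.parts) {t : ℝ}
    (ht : E.Knows k x t) (hu : u < σ.view + 1) : C.RankLE σ.cert := by
  obtain ⟨l, s, -, hs⟩ := hsync.unforgeable j hj k hk x t ht _ hx (by simp [Item.signer, hσ])
  obtain ⟨-, e, -, he, hmax⟩ := hprot.status_only j hj σ l s hσ hs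
  exact hmax.2 C ⟨hknown j hj _ hu e he.1, by omega⟩

/-- If `C'` is of a later view, an honest vote in it falls under `hlater`. If it is of view `u`, its
block is comparable with `B` and at least as high. The bound `r ≤ t` in `hlater` allows use inside
an induction on time. -/
theorem DirectCommit.suffix_of_rank (hΔ : 0 < E.Δ) (hsync : E.IsSynchronous)
    (hprot : E.FollowsProtocol) {i : Replica f} (hi : i ∈ E.honest)
    {u : ℕ} {B : Block β} {s : ℝ} (hc : E.DirectCommit i u B s) {C C' : Cert f β} {t : ℝ}
    (hC : C.block = B) (hCu : C.view = u) (hle : C.RankLE C') (hC' : E.Backed C' t)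
    (hlater : ∀ h ∈ E.honest, ∀ P r, r ≤ t → E.Votes h P r → u < P.view → B <:+ P.block) :
    B <:+ C'.block := by
  have hu := hc.1.1.one_le
  rcases hC' with rfl | hV
  · simp only [Cert.RankLE, genesisCert] at hle
    omega
  rcases hle with hlt | ⟨heq, hlen⟩
  · obtain ⟨h, hh, P, hPB, hPv, r, hr, hV⟩ := hV
    rw [← hPB]
    exact hlater h hh P r hr hV (by omega)
  · rw [← heq, hCu] at hV
    rcases (hc.2.2.honestVote hsync hprot hi).comparable hΔ hsync hprot hV with h | h
    · exact h
    · have := h.length_le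
      rw [hC] at hlen
      exact (h.eq_of_length_le hlen) ▸ List.suffix_rfl

/-- Safety across views: honest votes of later views extend directly committed blocks. -/
theorem DirectCommit.suffix_of_votes (hΔ : 0 < E.Δ) (hsync : E.IsSynchronous)
    (hprot : E.FollowsProtocol) {i : Replica f} (hi : i ∈ E.honest)
    {u : ℕ} {B : Block β} {s : ℝ} (hc : E.DirectCommit i u B s) {h : Replica f}
    (hh : h ∈ E.honest) {P : Proposal f β} {t : ℝ} (hV : E.Votes h P t) (hu : u < P.view) :
    B <:+ P.block := by
  obtain ⟨C, hCB, hCu, hknown⟩ := hc.exists_knownCert hΔ hsync hprot hi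
  -- Induction over time slices of length `Δ`: a vote at time `t` rests on certificates available
  -- when its timer started, at `t - Δ`. The base case is empty because later views are not entered
  -- before `s + Δ`.
  suffices key : ∀ n : ℕ, ∀ h ∈ E.honest, ∀ P t, E.Votes h P t → u < P.view →
      t < s + n * E.Δ → B <:+ P.block by
    obtain ⟨n, hn⟩ := exists_nat_gt ((t - s) / E.Δ)
    rw [div_lt_iff₀ hΔ] at hn
    exact key n h hh P t hV hu (by linarith)
  intro n
  induction n with
  | zero =>
    intro h hh P t hV hu ht
    have := hc.le_of_enteredBy hsync hprot hi hh (hV.2.1.1.of_le hΔ (by omega) hu)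
    simp at ht
    linarith
  | succ n ih =>
    intro h hh P t hV hu ht
    have hlater : ∀ h ∈ E.honest, ∀ P r, r ≤ t - E.Δ → E.Votes h P r → u < P.view →
        B <:+ P.block := fun h hh P r hr hV hu => ih h hh P r hV hu (by
          push_cast at ht
          linarith)
    obtain ⟨hPv, hact, hkn, -, ⟨S, C', hS, hmax, hsuf⟩ | ⟨-, C', hmax, hsuf⟩⟩ := hV.1.1
    · obtain ⟨hcard, hinj, hval⟩ := hPv.2.2.2 S hS
      classical
      -- Having `f + 1` distinct signers, `S` contains an honest status, which ranks at least as
      -- high as `C`; hence so does the highest one in `S`.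
      have hsig : (S.image Status.signer).card = f + 1 := by
        rw [Finset.card_image_of_injOn fun σ hσ τ hτ => hinj σ hσ τ hτ, hcard]
      obtain ⟨j, hjS, hj⟩ := exists_honest_of_card hsync hsig
      obtain ⟨σ, hσ, hσj⟩ := Finset.mem_image.1 hjS
      have h₁ : C.RankLE σ.cert := rankLE_of_status hsync hprot hj hh hCu hknown hσj
        (x := .propose P) (.inr ⟨S, hS, σ, hσ, .inl rfl⟩) hkn (by have := (hval σ hσ).2; omega)
      have h₂ : E.Backed C' (t - E.Δ) := by
        obtain ⟨σ', hσ', rfl⟩ := hmax.1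
        rcases (hval σ' hσ').1.1 with hg | ⟨-, hcard'⟩
        · exact .inl hg
        · exact .inr (honestVote_of_quorum hsync hprot hh hcard'
            fun j hj => ⟨_, hkn, .inr ⟨S, hS, σ', hσ', .inr ⟨j, hj, rfl⟩⟩⟩)
      exact (hc.suffix_of_rank hΔ hsync hprot hi hCB hCu
        (h₁.trans (hmax.2 _ ⟨σ, hσ, rfl⟩)) h₂ hlater).trans hsuf
    · have h₁ : C.RankLE C' := hmax.2 C (hknown h hh P.view hu _ hact.1)
      exact (hc.suffix_of_rank hΔ hsync hprot hi hCB hCu h₁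
        (KnownCert.backed hsync hprot hh hmax.1) hlater).trans hsuf

end Execution

end DeltaSMR

namespace DeltaSMR

/-! ### Highest known certificates and the start of vote-timers -/

theorem exists_isHighest {f : ℕ} {β : Type*} {K : Set (Cert f β)} (hK : K.Finite)
    (hne : K.Nonempty) : ∃ C, IsHighest K C := by
  obtain ⟨C, hC, hmax⟩ := Set.exists_max_image K
    (fun C => toLex (C.view, C.block.length)) hK hne
  refine ⟨C, hC, fun D hD => ?_⟩
  have := hmax D hD
  rw [Prod.Lex.toLex_le_toLex] at this
  exact this

namespace Execution

variable {f : ℕ} {β : Type*} {E : Execution f β}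

/-- A certificate other than that of genesis is determined by one received vote and its signer set,
or lies in the finite set `S` of a received proposal. -/
theorem finite_knownCert (hsync : E.IsSynchronous) {i : Replica f} (hi : i ∈ E.honest) (t : ℝ) :
    {D | E.KnownCert i D t}.Finite := by
  have hX := hsync.finite_arrivals i hi t
  have h₁ : (⋃ x ∈ {x | E.Knows i x t}, ⋃ Q : Finset (Replica f),
      {D : Cert f β | ∃ j, x = .vote j D.block D.view ∧ D.signers = Q}).Finite := by
    refine hX.biUnion fun x _ => Set.finite_iUnion fun Q => Set.Subsingleton.finite ?_
    rintro ⟨B, v, R⟩ ⟨j, rfl, rfl⟩ ⟨B', v', R'⟩ ⟨j', h, rfl⟩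
    simp only [Item.vote.injEq] at h
    obtain ⟨-, rfl, rfl⟩ := h
    rfl
  have h₂ : (⋃ x ∈ {x | E.Knows i x t},
      {D : Cert f β | ∃ P S, x = .propose P ∧ P.statuses = some S ∧
        ∃ σ ∈ S, σ.cert = D}).Finite := by
    refine hX.biUnion fun x _ => ?_
    by_cases hx : ∃ P S, x = .propose P ∧ P.statuses = some S
    · obtain ⟨P, S, rfl, hS⟩ := hx
      refine ((Finset.finite_toSet S).image Status.cert).subset ?_
      rintro D ⟨P', S', h, hS', σ, hσ, rfl⟩
      obtain rfl : P = P' := by simpa using h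
      obtain rfl : S = S' := by simpa [hS] using hS'
      exact ⟨σ, hσ, rfl⟩
    · refine Set.Finite.subset Set.finite_empty ?_
      rintro D ⟨P, S, h, hS, -⟩
      exact hx ⟨P, S, h, hS⟩
  refine ((Set.finite_singleton (genesisCert f β)).union (h₁.union h₂)).subset ?_
  rintro D (h | ⟨-, hcard, r, hr, -, h⟩ | ⟨P, S, -, hS, hσ, -, r, hr, -, h⟩)
  · exact .inl h
  · obtain ⟨j, hj⟩ := Finset.card_pos.1 (by omega : 0 < D.signers.card)
    exact .inr (.inl (Set.mem_biUnion (show E.Knows i (.vote j D.block D.view) t from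
      (h j hj).mono hr) (Set.mem_iUnion.2 ⟨D.signers, j, rfl, rfl⟩)))
  · exact .inr (.inr (Set.mem_biUnion (show E.Knows i (.propose P) t from h.mono hr)
      ⟨P, S, rfl, hS, hσ⟩))

theorem exists_isHighest_knownCert (hsync : E.IsSynchronous) {i : Replica f}
    (hi : i ∈ E.honest) (t : ℝ) : ∃ C, IsHighest {D | E.KnownCert i D t} C :=
  exists_isHighest (finite_knownCert hsync hi t) ⟨genesisCert f β, .inl rfl⟩

theorem KnownCert.mono {i : Replica f} {C : Cert f β} {s t : ℝ} (h : E.KnownCert i C s)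
    (hst : s ≤ t) : E.KnownCert i C t := by
  rcases h with h | ⟨hv, hcard, r, hr, h⟩ | ⟨P, S, hP, hS, hσ, hen, r, hr, h⟩
  · exact .inl h
  · exact .inr (.inl ⟨hv, hcard, r, hr.trans hst, h⟩)
  · exact .inr (.inr ⟨P, S, hP, hS, hσ, hen.mono hst, r, hr.trans hst, h⟩)

/-- If nothing arrives and no view of a known proposal is entered between `a` and `t`, then the
timer condition at time `t` held at time `a` already. -/
theorem TimerCond.of_no_event {i : Replica f} {P : Proposal f β} {a t : ℝ}
    (h : E.TimerCond i P t) (hat : a ≤ t) (hx : ∀ x, E.Knows i x t → E.Knows i x a)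
    (hen : ∀ P : Proposal f β, E.Knows i (.propose P) t → E.EnteredBy i P.view t →
      E.EnteredBy i P.view a) : E.TimerCond i P a := by
  have hcert : ∀ D, E.KnownCert i D t ↔ E.KnownCert i D a := by
    refine fun D => ⟨fun hD => ?_, fun hD => hD.mono hat⟩
    -- Moving a time of receipt back to `min r a` keeps the condition that the next view was not
    -- entered before it.
    have hmin : ∀ r ≤ t, ∀ x, E.Knows i x r → E.Knows i x (min r a) := by
      intro r hr x hxr
      rcases le_total r a with h | h
      · rwa [min_eq_left h]
      · rw [min_eq_right h]
        exact hx x (hxr.mono hr)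
    rcases hD with h | ⟨hv, hcard, r, hr, hn, h⟩ | ⟨Q, S, hQ, hS, hσ, hQe, r, hr, hn, h⟩
    · exact .inl h
    · exact .inr (.inl ⟨hv, hcard, min r a, min_le_right _ _,
        fun s hs => hn s (lt_of_lt_of_le hs (min_le_left _ _)), fun j hj => hmin r hr _ (h j hj)⟩)
    · exact .inr (.inr ⟨Q, S, hQ, hS, hσ, hen Q (h.mono hr) hQe, min r a, min_le_right _ _,
        fun s hs => hn s (lt_of_lt_of_le hs (min_le_left _ _)), hmin r hr _ h⟩)
  obtain ⟨hP, hact, hk, hchain, hS⟩ := h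
  refine ⟨hP, ⟨hen P hk hact.1, fun s hs => hact.2 s (hs.trans_le hat)⟩, hx _ hk,
    fun A hA hAP => ?_, ?_⟩
  · obtain h | h | ⟨Q, hQ, h⟩ := hchain A hA hAP
    · exact .inl h
    · exact .inr (.inl (hx _ h))
    · exact .inr (.inr ⟨Q, hQ, hx _ h⟩)
  · simpa only [hcert] using hS

/-- The condition is not monotone in time: a higher certificate or a blame certificate can end it.
It can begin only at an arrival or at the entry into the view of a received proposal, and there are
finitely many of these. -/
theorem TimerCond.exists_startsTimer (hsync : E.IsSynchronous) {i : Replica f}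
    (hi : i ∈ E.honest) {P : Proposal f β} {t : ℝ} (h : E.TimerCond i P t) :
    ∃ τ ≤ t, E.StartsTimer i P τ := by
  have hX := hsync.finite_arrivals i hi t
  set F : Set ℝ := (fun x => (E.arrival i x).untopD 0) '' {x | E.Knows i x t} ∪
    ⋃ x ∈ {x | E.Knows i x t}, {a | ∃ P : Proposal f β, x = .propose P ∧ E.EntersAt i P.view a}
    with hFdef
  have hF : F.Finite := by
    refine (hX.image _).union (hX.biUnion fun x _ => Set.Subsingleton.finite ?_)
    rintro a ⟨P, rfl, ha⟩ b ⟨Q, hQ, hb⟩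
    obtain rfl : P = Q := by simpa using hQ
    exact ha.unique hb
  have harr : ∀ s ≤ t, ∀ x, E.Knows i x s → ∃ b ∈ F, b ≤ s ∧ E.Knows i x b := by
    intro s hs x hx
    obtain ⟨b, hb⟩ := WithTop.ne_top_iff_exists.1 (ne_top_of_le_ne_top WithTop.coe_ne_top hx)
    refine ⟨b, .inl ⟨x, hx.mono hs, by simp [← hb]⟩, ?_, hb.symm.le⟩
    have hx' : E.arrival i x ≤ (s : WithTop ℝ) := hx
    rw [← hb] at hx'
    exact WithTop.coe_le_coe.1 hx'
  refine exists_first hF (fun s hs hΦ => ?_) h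
  obtain ⟨b, hbF, hbs, -⟩ := harr s hs _ hΦ.2.2.1
  -- `a` is the last event up to time `s`.
  obtain ⟨a, ⟨haF, has⟩, hmax⟩ := Set.exists_max_image {b ∈ F | b ≤ s} id
    (hF.subset fun _ hx => hx.1) ⟨b, hbF, hbs⟩
  refine ⟨a, haF, has, hΦ.of_no_event has (fun x hx => ?_) fun Q hQ hen => ?_⟩
  · obtain ⟨b, hb, hbs, hxb⟩ := harr s hs x hx
    exact hxb.mono (hmax b ⟨hb, hbs⟩)
  · obtain ⟨e, he, hee⟩ := hen.exists_entersAt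
    exact hee.1.mono (hmax e ⟨.inr (Set.mem_biUnion (show E.Knows i (.propose Q) t from
      hQ.mono hs) ⟨Q, rfl, hee⟩), he⟩)

/-! ### The proposals of an honest leader -/

/-- A first proposal with parent `C`: genesis in view `1`, and otherwise the highest certified block
among the received `status` messages. -/
def FirstProposalOn (E : Execution f β) (v : ℕ) (t : ℝ) (P : Proposal f β) (C : Cert f β) : Prop :=
  ∃ b, P.block = b :: C.block ∧
    ((v = 1 ∧ P.statuses = none ∧ C = genesisCert f β) ∨
     (v ≠ 1 ∧ ∃ S, P.statuses = some S ∧ (∀ σ ∈ S, E.Knows (leader f v) (.status σ) t) ∧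
      (∃ σ ∈ S, σ.cert = C) ∧
      IsHighest {D | ∃ σ : Status f β, σ.Valid ∧ σ.view + 1 = v ∧
        E.Knows (leader f v) (.status σ) t ∧ σ.cert = D} C))

theorem FirstProposal.exists_on {v : ℕ} {t : ℝ} {P : Proposal f β} (h : E.FirstProposal v t P) :
    ∃ C, E.FirstProposalOn v t P C := by
  obtain ⟨-, -, ⟨hv, hS, b, hb⟩ | ⟨hv, S, C, b, hS, hk, hC, hmax, hb⟩⟩ := h
  · exact ⟨genesisCert f β, b, hb, .inl ⟨hv, hS, rfl⟩⟩
  · exact ⟨C, b, hb, .inr ⟨hv, S, hS, hk, hC, hmax⟩⟩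

/-- `P 0, P 1, …` are the proposals of the leader of view `v`, able to propose from time `T` on. -/
structure Schedule (E : Execution f β) (v : ℕ) (T : ℝ) (P : ℕ → Proposal f β) : Prop where
  first : E.FirstProposal v T (P 0)
  later : ∀ k, (P (k + 1)).Valid E.valid ∧ (P (k + 1)).view = v ∧ (P (k + 1)).statuses = none ∧
    ∃ b, (P (k + 1)).block = b :: (P k).block
  broadcast : ∀ k : ℕ, E.Active (leader f v) v (T + k * E.α) →
    E.Broadcast (leader f v) (.propose (P k)) (T + k * E.α)
  only : ∀ Q j s, E.sends (leader f v) j (.propose Q) s → Q.view = v →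
    ∃ k : ℕ, Q = P k ∧ T + k * E.α ≤ s ∧ E.Active (leader f v) v (T + k * E.α)

namespace Schedule

variable {v : ℕ} {T : ℝ} {P : ℕ → Proposal f β}

theorem valid (h : E.Schedule v T P) (k : ℕ) : (P k).Valid E.valid := by
  cases k with
  | zero => exact h.first.1
  | succ k => exact (h.later k).1

theorem view (h : E.Schedule v T P) (k : ℕ) : (P k).view = v := by
  cases k with
  | zero => exact h.first.2.1
  | succ k => exact (h.later k).2.1

theorem eq_zero_of_statuses (h : E.Schedule v T P) {k : ℕ} (hk : (P k).statuses ≠ none) :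
    k = 0 := by
  cases k with
  | zero => rfl
  | succ k => exact absurd (h.later k).2.2.1 hk

theorem suffix (h : E.Schedule v T P) {m k : ℕ} (hmk : m ≤ k) : (P m).block <:+ (P k).block := by
  induction k, hmk using Nat.le_induction with
  | base => exact List.suffix_rfl
  | succ k _ ih =>
    obtain ⟨b, hb⟩ := (h.later k).2.2.2
    rw [hb]
    exact ih.trans (List.suffix_cons _ _)

theorem length (h : E.Schedule v T P) (k : ℕ) :
    (P k).block.length = (P 0).block.length + k := by
  induction k with
  | zero => rfl
  | succ k ih =>
    obtain ⟨b, hb⟩ := (h.later k).2.2.2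
    rw [hb, List.length_cons, ih, add_assoc]

theorem suffix_cases (h : E.Schedule v T P) {C : Cert f β} (hC : E.FirstProposalOn v T (P 0) C)
    {A : Block β} {k : ℕ} (hA : A <:+ (P k).block) :
    (∃ m ≤ k, A = (P m).block) ∨ A <:+ C.block := by
  induction k with
  | zero =>
    obtain ⟨b, hb, -⟩ := hC
    rw [hb] at hA
    rcases List.suffix_cons_iff.1 hA with hA | hA
    · exact .inl ⟨0, le_rfl, hA.trans hb.symm⟩
    · exact .inr hA
  | succ k ih =>
    obtain ⟨b, hb⟩ := (h.later k).2.2.2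
    rw [hb] at hA
    rcases List.suffix_cons_iff.1 hA with hA | hA
    · exact .inl ⟨k + 1, le_rfl, hA.trans hb.symm⟩
    · rcases ih hA with ⟨m, hm, hA⟩ | hA
      · exact .inl ⟨m, by omega, hA⟩
      · exact .inr hA

theorem parent_suffix (h : E.Schedule v T P) {C : Cert f β}
    (hC : E.FirstProposalOn v T (P 0) C) (k : ℕ) : C.block <:+ (P k).block := by
  obtain ⟨b, hb, -⟩ := hC
  exact (hb ▸ List.suffix_cons b C.block).trans (h.suffix (Nat.zero_le k))

theorem of_knows (h : E.Schedule v T P) (hsync : E.IsSynchronous) (hL : leader f v ∈ E.honest)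
    {j : Replica f} (hj : j ∈ E.honest) {Q : Proposal f β} {t : ℝ}
    (hQ : E.Knows j (.propose Q) t) (hv : Q.view = v) : ∃ k : ℕ, Q = P k ∧ T + k * E.α ≤ t := by
  obtain ⟨l, s, hs, hsend⟩ := hsync.unforgeable _ hL j hj _ t hQ _ (Item.mem_parts_self _)
    (by simp [Item.signer, hv])
  obtain ⟨k, hk, hks, -⟩ := h.only Q l s hsend hv
  exact ⟨k, hk, hks.trans hs⟩

/-- The proposals form one chain, and only the first can have `S ≠ ⊥`. -/
theorem not_equivKnown (h : E.Schedule v T P) (hsync : E.IsSynchronous)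
    (hL : leader f v ∈ E.honest) {j : Replica f} (hj : j ∈ E.honest) (t : ℝ) :
    ¬ E.EquivKnown j v t := by
  rintro ⟨Q, R, -, -, hQv, hRv, ⟨-, hQR⟩, hQ, hR⟩
  obtain ⟨k, rfl, -⟩ := h.of_knows hsync hL hj hQ hQv
  obtain ⟨m, rfl, -⟩ := h.of_knows hsync hL hj hR hRv
  rcases hQR with ⟨h₁, h₂⟩ | ⟨hne, h₁, h₂⟩
  · rcases le_total k m with hkm | hkm
    · exact h₁ (h.suffix hkm)
    · exact h₂ (h.suffix hkm)
  · rw [h.eq_zero_of_statuses h₁, h.eq_zero_of_statuses h₂] at hne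
    exact hne rfl

/-- The extra `Δ` is the voter's timer. It ensures that by `T + kα + Δ` no honest vote is for a
proposal of index above `k`. -/
theorem of_honestVote (h : E.Schedule v T P) (hsync : E.IsSynchronous)
    (hL : leader f v ∈ E.honest) {B : Block β} {t : ℝ} (hB : E.HonestVote B v t) :
    ∃ k : ℕ, B = (P k).block ∧ T + k * E.α + E.Δ ≤ t := by
  obtain ⟨g, hg, Q, rfl, hv, s, hs, hV⟩ := hB
  obtain ⟨k, rfl, hk⟩ := h.of_knows hsync hL hg hV.1.1.2.2.1 hv
  exact ⟨k, rfl, by linarith⟩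

end Schedule

/-! ### Consequences of the absence of blames -/

/-- Until (and not including) time `d`, no honest replica sends its blame of view `v`. -/
def NoBlameBefore (E : Execution f β) (v : ℕ) (d : ℝ) : Prop :=
  ∀ i ∈ E.honest, ∀ j, ∀ s < d, ¬ E.sends i j (.blame i v) s

theorem NoBlameBefore.mono {v : ℕ} {c d : ℝ} (h : E.NoBlameBefore v d) (hcd : c ≤ d) :
    E.NoBlameBefore v c :=
  fun i hi j s hs => h i hi j s (hs.trans_le hcd)

theorem NoBlameBefore.not_hasBlameCert (hsync : E.IsSynchronous) {v : ℕ} {d : ℝ}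
    (h : E.NoBlameBefore v d) {i : Replica f} (hi : i ∈ E.honest) {s : ℝ} (hs : s < d) :
    ¬ E.HasBlameCert i v s := by
  rintro ⟨Q, hQ, hk⟩
  obtain ⟨j, hjQ, hj⟩ := exists_honest_of_card hsync hQ
  obtain ⟨l, r, hr, hsend⟩ :=
    hsync.unforgeable j hj i hi _ s (hk j hjQ) _ (Item.mem_parts_self _) rfl
  exact h j hj l r (hr.trans_lt hs) hsend

/-- The case `t = d` is included, since activity at `t` only excludes certificates held strictly
before `t`. -/
theorem NoBlameBefore.active (hsync : E.IsSynchronous) {v : ℕ} {d : ℝ}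
    (h : E.NoBlameBefore v d) {i : Replica f} (hi : i ∈ E.honest) {t : ℝ} (ht : t ≤ d)
    (he : E.EnteredBy i v t) : E.Active i v t :=
  ⟨he, fun _ hs => h.not_hasBlameCert hsync hi (hs.trans_le ht)⟩

theorem NoBlameBefore.le_of_enteredBy (hΔ : 0 < E.Δ) (hsync : E.IsSynchronous) {v : ℕ} {d : ℝ}
    (h : E.NoBlameBefore v d) {i : Replica f} (hi : i ∈ E.honest) (hv : 1 ≤ v) {t : ℝ}
    (ht : t ≤ d) {w : ℕ} (he : E.EnteredBy i w t) : w ≤ v := by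
  by_contra! hw
  exact h.not_hasBlameCert hsync hi (by linarith) (he.of_lt hΔ hv hw).2

/-! ### The first proposal and the rank of its parent -/

theorem _root_.DeltaSMR.Cert.Valid.eq_genesis {C : Cert f β} (h : C.Valid) (hv : C.view < 1) :
    C = genesisCert f β := by
  rcases h with h | ⟨h, -⟩
  · exact h
  · omega

/-- The leader's wait of `2Δ` covers the skew and the delay of a `status` message; view `1` has no
wait and needs no status. -/
theorem EntersAt.le_firstProposalTime (hΔ : 0 < E.Δ) (hsync : E.IsSynchronous)
    (hprot : E.FollowsProtocol) {v : ℕ} (hL : leader f v ∈ E.honest) {e e' : ℝ}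
    (he : E.EntersAt (leader f v) v e) {i : Replica f} (hi : i ∈ E.honest)
    (he' : E.EntersAt i v e') :
    e' ≤ E.firstProposalTime v e + E.Δ ∧ (v ≠ 1 → e' + E.Δ ≤ E.firstProposalTime v e) := by
  have := he.skew hsync hprot hL hi he'
  unfold firstProposalTime
  split_ifs with h
  · exact ⟨this, fun h' => absurd h h'⟩
  · exact ⟨by linarith, fun _ => by linarith⟩

/-- The leader of a later view receives the `status` messages of all honest replicas in time. -/
theorem EntersAt.exists_status (hΔ : 0 < E.Δ) (hsync : E.IsSynchronous)
    (hprot : E.FollowsProtocol) {v : ℕ} (hv : v ≠ 1) (hL : leader f v ∈ E.honest) {e e' : ℝ}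
    (he : E.EntersAt (leader f v) v e) {i : Replica f} (hi : i ∈ E.honest)
    (he' : E.EntersAt i v e') :
    ∃ σ : Status f β, σ.signer = i ∧ σ.Valid ∧ σ.view + 1 = v ∧
      E.Knows (leader f v) (.status σ) (E.firstProposalTime v e) ∧
      IsHighest {D | E.KnownCert i D e' ∧ D.view < v} σ.cert := by
  have h1 := he.1.one_le
  obtain ⟨u, rfl⟩ := Nat.exists_eq_add_of_le' h1
  obtain ⟨C, hC, hsend⟩ := hprot.status i hi u e' (by omega) he'
  refine ⟨⟨i, C, u⟩, rfl, ⟨KnownCert.valid hC.1.1, hC.1.2⟩, rfl,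
    (hsync.delivery i hi _ hL _ _ hsend).mono
      ((he.le_firstProposalTime hΔ hsync hprot hL hi he').2 hv), ?_⟩
  simpa only [Nat.lt_succ_iff] using hC

/-- This rules out the case of `ProposesFrom` in which the leader stays silent. For `v ≠ 1`, `S`
joins a status with the highest certificate, perhaps of a Byzantine signer, to those of `f` other
honest replicas. -/
theorem EntersAt.exists_firstProposal (hΔ : 0 < E.Δ)
    (hvalid : ∀ B : Block β, ∃ b : β, E.valid (b :: B)) (hsync : E.IsSynchronous)
    (hprot : E.FollowsProtocol) {v : ℕ} (hL : leader f v ∈ E.honest) {e : ℝ}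
    (he : E.EntersAt (leader f v) v e) : ∃ P, E.FirstProposal v (E.firstProposalTime v e) P := by
  have h1 := he.1.one_le
  by_cases hv : v = 1
  · obtain ⟨b, hb⟩ := hvalid []
    exact ⟨⟨[b], none, v⟩, ⟨h1, by simp, hb, fun S hS => by simp at hS⟩, rfl,
      .inl ⟨hv, rfl, b, rfl⟩⟩
  set T := E.firstProposalTime v e
  have hstat : ∀ i ∈ E.honest, ∃ σ : Status f β, σ.signer = i ∧ σ.Valid ∧ σ.view + 1 = v ∧
      E.Knows (leader f v) (.status σ) T := by
    intro i hi
    obtain ⟨e', -, he'⟩ := (he.1.skew hsync hprot hL hi).exists_entersAt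
    obtain ⟨σ, h₁, h₂, h₃, h₄, -⟩ := he.exists_status hΔ hsync hprot hv hL hi he'
    exact ⟨σ, h₁, h₂, h₃, h₄⟩
  have : Nonempty (Status f β) := ⟨⟨leader f v, genesisCert f β, 0⟩⟩
  choose! st hsig hval hview hkn using hstat
  have hfin : {D | ∃ σ : Status f β, σ.Valid ∧ σ.view + 1 = v ∧
      E.Knows (leader f v) (.status σ) T ∧ σ.cert = D}.Finite := by
    refine (((hsync.finite_arrivals _ hL T).preimage (f := Item.status)
      (fun σ _ τ _ h => by simpa using h)).image Status.cert).subset ?_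
    rintro D ⟨σ, -, -, hσ, rfl⟩
    exact ⟨σ, hσ, rfl⟩
  obtain ⟨C, ⟨σ, hσval, hσv, hσk, rfl⟩, hmax⟩ := exists_isHighest hfin
    ⟨_, st _, hval _ hL, hview _ hL, hkn _ hL, rfl⟩
  classical
  have hcard : f ≤ (E.honest.erase σ.signer).card := by
    have h₁ := hsync.honest_card
    have h₂ := Finset.pred_card_le_card_erase (s := E.honest) (a := σ.signer)
    omega
  obtain ⟨H, hH, hHcard⟩ := Finset.exists_subset_card_eq hcard
  have hHh : ∀ j ∈ H, j ≠ σ.signer ∧ j ∈ E.honest := fun j hj => Finset.mem_erase.1 (hH hj)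
  have hnot : σ ∉ H.image st := by
    intro hmem
    obtain ⟨j, hj, hjσ⟩ := Finset.mem_image.1 hmem
    exact (hHh j hj).1 (by rw [← hsig j (hHh j hj).2, hjσ])
  have hmem : ∀ τ ∈ insert σ (H.image st), (τ = σ ∨ ∃ j ∈ H, st j = τ) := by
    intro τ hτ
    simpa using hτ
  have hprop : ∀ τ ∈ insert σ (H.image st), τ.Valid ∧ τ.view + 1 = v ∧
      E.Knows (leader f v) (.status τ) T := by
    intro τ hτ
    rcases hmem τ hτ with rfl | ⟨j, hj, rfl⟩
    · exact ⟨hσval, hσv, hσk⟩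
    · exact ⟨hval j (hHh j hj).2, hview j (hHh j hj).2, hkn j (hHh j hj).2⟩
  obtain ⟨b, hb⟩ := hvalid σ.cert.block
  refine ⟨⟨b :: σ.cert.block, some (insert σ (H.image st)), v⟩,
    ⟨h1, by simp, hb, fun S hS => ?_⟩, rfl,
    .inr ⟨hv, _, σ.cert, b, rfl, fun τ hτ => (hprop τ hτ).2.2,
      ⟨σ, Finset.mem_insert_self _ _, rfl⟩, ⟨⟨σ, hσval, hσv, hσk, rfl⟩, hmax⟩, rfl⟩⟩
  obtain rfl : insert σ (H.image st) = S := by simpa using hS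
  refine ⟨?_, fun τ hτ τ' hτ' h => ?_, fun τ hτ => ⟨(hprop τ hτ).1, (hprop τ hτ).2.1⟩⟩
  · rw [Finset.card_insert_of_notMem hnot, Finset.card_image_of_injOn, hHcard]
    intro j hj k hk hjk
    rw [← hsig j (hHh j hj).2, hjk, hsig k (hHh k hk).2]
  · rcases hmem τ hτ with rfl | ⟨j, hj, rfl⟩ <;> rcases hmem τ' hτ' with rfl | ⟨k, hk, rfl⟩
    · rfl
    · rw [hsig k (hHh k hk).2] at h
      exact absurd h.symm (hHh k hk).1
    · rw [hsig j (hHh j hj).2] at h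
      exact absurd h (hHh j hj).1
    · rw [hsig j (hHh j hj).2, hsig k (hHh k hk).2] at h
      rw [h]

theorem EntersAt.exists_schedule (hΔ : 0 < E.Δ)
    (hvalid : ∀ B : Block β, ∃ b : β, E.valid (b :: B)) (hsync : E.IsSynchronous)
    (hprot : E.FollowsProtocol) {v : ℕ} (hL : leader f v ∈ E.honest) {e : ℝ}
    (he : E.EntersAt (leader f v) v e) : ∃ P, E.Schedule v (E.firstProposalTime v e) P := by
  rcases hprot.propose v e hL he with ⟨P, h₁, h₂, h₃, h₄⟩ | ⟨hno, -⟩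
  · exact ⟨P, h₁, h₂, h₃, h₄⟩
  · exact absurd (he.exists_firstProposal hΔ hvalid hsync hprot hL) hno

/-- The certificates of earlier views that a replica knows in view `v` are those that it knew when
it entered the view and those contained in proposals of the view. -/
theorem KnownCert.of_earlier_view (hΔ : 0 < E.Δ) {i : Replica f} {v : ℕ} {e t : ℝ}
    (he : E.EntersAt i v e) (hmax : ∀ w, E.EnteredBy i w t → w ≤ v) {D : Cert f β}
    (hD : E.KnownCert i D t) (hDv : D.view < v) :
    E.KnownCert i D e ∨ ∃ (P : Proposal f β) (S : Finset (Status f β)), P.Valid E.valid ∧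
      P.view = v ∧ P.statuses = some S ∧ (∃ σ ∈ S, σ.cert = D) ∧ E.Knows i (.propose P) t := by
  -- Whatever counts for view `u` was received no later than the entry into `u + 1`, hence no later
  -- than `e`.
  have hle : ∀ u, u < v → ∀ r, (∀ s < r, ¬ E.EnteredBy i (u + 1) s) → r ≤ e :=
    fun u hu r hr => not_lt.1 fun h => hr e h (he.1.of_le hΔ (by omega) hu)
  rcases hD with h | ⟨h1, hcard, r, hr, hn, h⟩ | ⟨Q, S, hQ, hS, hσ, hQe, r, hr, hn, h⟩
  · exact .inl (.inl h)
  · exact .inl (.inr (.inl ⟨h1, hcard, r, hle _ hDv r hn, hn, h⟩))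
  · rcases (hmax _ hQe).eq_or_lt with hQv | hQv
    · exact .inr ⟨Q, S, hQ, hQv, hS, hσ, h.mono hr⟩
    · exact .inl (.inr (.inr ⟨Q, S, hQ, hS, hσ, he.1.of_le hΔ hQ.1 hQv.le,
        r, hle _ hQv r hn, hn, h⟩))

/-- What `i` knew on entering is dominated by its own status, which reached the leader in time.
Anything learnt afterwards comes from the set `S` of the leader's first proposal, over which `C` is
highest. -/
theorem KnownCert.rankLE_parent (hΔ : 0 < E.Δ) (hsync : E.IsSynchronous)
    (hprot : E.FollowsProtocol) {v : ℕ} (hL : leader f v ∈ E.honest) {e : ℝ}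
    (he : E.EntersAt (leader f v) v e) {P : ℕ → Proposal f β} {C : Cert f β}
    (hP : E.Schedule v (E.firstProposalTime v e) P)
    (hC : E.FirstProposalOn v (E.firstProposalTime v e) (P 0) C)
    {i : Replica f} (hi : i ∈ E.honest) {e' t : ℝ} (he' : E.EntersAt i v e')
    (hmax : ∀ w, E.EnteredBy i w t → w ≤ v) {D : Cert f β}
    (hD : E.KnownCert i D t) (hDv : D.view < v) : D.RankLE C := by
  obtain ⟨b, -, ⟨rfl, -, rfl⟩ | ⟨hv, S, hS, hSk, -, hCmax⟩⟩ := hC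
  · exact .inr (by rw [hD.valid.eq_genesis hDv]; simp)
  · rcases hD.of_earlier_view hΔ he' hmax hDv with hD | ⟨Q, S', hQ, hQv, hS', ⟨σ, hσ, rfl⟩, hk⟩
    · obtain ⟨σ, -, h₁, h₂, h₃, h₄⟩ := he.exists_status hΔ hsync hprot hv hL hi he'
      exact (h₄.2 D ⟨hD, hDv⟩).trans (hCmax.2 _ ⟨σ, h₁, h₂, h₃, rfl⟩)
    · obtain ⟨k, rfl, -⟩ := hP.of_knows hsync hL hi hk hQv
      obtain rfl := hP.eq_zero_of_statuses (k := k) (by simp [hS'])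
      obtain rfl : S' = S := by simpa [hS'] using hS
      obtain ⟨-, -, hval⟩ := hQ.2.2.2 S' hS'
      exact hCmax.2 _ ⟨σ, (hval σ hσ).1, (hval σ hσ).2.trans hQv, hSk σ hσ, rfl⟩

theorem FirstProposalOn.backed (hsync : E.IsSynchronous) (hprot : E.FollowsProtocol) {v : ℕ}
    (hL : leader f v ∈ E.honest) {t : ℝ} {P : Proposal f β} {C : Cert f β}
    (hC : E.FirstProposalOn v t P C) : E.Backed C t := by
  obtain ⟨b, -, ⟨-, -, rfl⟩ | ⟨-, S, -, -, -, ⟨⟨σ, hσ, -, hk, rfl⟩, -⟩⟩⟩ := hC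
  · exact .inl rfl
  · exact backed_of_knows_status hsync hprot hL hσ hk

/-! ### Timely commits and no blames under an honest leader -/

/-- The proposals of an honest leader are not committed in earlier views. -/
theorem Schedule.not_committedIn (hΔ : 0 < E.Δ) (hsync : E.IsSynchronous)
    (hprot : E.FollowsProtocol) {v : ℕ} (hL : leader f v ∈ E.honest) {e : ℝ}
    (he : E.EntersAt (leader f v) v e) {P : ℕ → Proposal f β}
    (hP : E.Schedule v (E.firstProposalTime v e) P)
    {i : Replica f} (hi : i ∈ E.honest) {u : ℕ} (hu : u < v) (k : ℕ) (s : ℝ) :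
    ¬ E.CommittedIn i u (P k).block s := by
  rintro ⟨-, B, hB, r, -, hc⟩
  obtain ⟨C, hC⟩ := hP.first.exists_on
  obtain ⟨e', -, he'⟩ := (he.1.skew hsync hprot hL hi).exists_entersAt
  have hmax : ∀ w, E.EnteredBy i w e' → w ≤ v := by
    intro w hw
    by_contra! hvw
    have := he'.le (hw.of_lt hΔ he.1.one_le hvw).1
    linarith
  obtain ⟨C', hC'B, hC'u, hknown⟩ := hc.exists_knownCert hΔ hsync hprot hi
  have hrank : C'.RankLE C := (hknown i hi v hu e' he'.1).rankLE_parent hΔ hsync hprot hL he hP hC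
    hi he' hmax (by omega)
  -- A block committed earlier would be an ancestor of the parent `C.block`, but every proposal is
  -- longer than it.
  have h₁ := (hB.trans (hc.suffix_of_rank hΔ hsync hprot hi hC'B hC'u hrank
    (hC.backed hsync hprot hL)
    fun h hh Q q _ hV hQ => hc.suffix_of_votes hΔ hsync hprot hi hh hV hQ)).length_le
  have h₂ := hP.length k
  obtain ⟨b, hb, -⟩ := hC
  rw [hb, List.length_cons] at h₂
  omega

/-- Honest replicas start the vote-timer of an honest leader's proposal within `Δ`. -/
theorem Schedule.timerCond (hΔ : 0 < E.Δ) (hα : 0 < E.α) (hsync : E.IsSynchronous)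
    (hprot : E.FollowsProtocol) {v : ℕ} (hL : leader f v ∈ E.honest) {e : ℝ}
    (he : E.EntersAt (leader f v) v e) {P : ℕ → Proposal f β} {T : ℝ}
    (hT : E.firstProposalTime v e = T) (hP : E.Schedule v T P)
    {i : Replica f} (hi : i ∈ E.honest) {k : ℕ}
    (hno : E.NoBlameBefore v (T + k * E.α + E.Δ)) :
    E.TimerCond i (P k) (T + k * E.α + E.Δ) := by
  subst hT
  set T := E.firstProposalTime v e with hT
  set t := T + k * E.α + E.Δ with ht
  have h1 := he.1.one_le
  have heT : e ≤ T := by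
    rw [hT]
    unfold firstProposalTime
    split_ifs <;> linarith
  have hmα : ∀ m ≤ k, (m : ℝ) * E.α ≤ k * E.α := fun m hm =>
    mul_le_mul_of_nonneg_right (Nat.cast_le.2 hm) hα.le
  have hmα0 : ∀ m : ℕ, 0 ≤ (m : ℝ) * E.α := fun m => mul_nonneg (Nat.cast_nonneg m) hα.le
  have hk0 := hmα0 k
  have hkn : ∀ m ≤ k, E.Knows i (.propose (P m)) t := by
    intro m hm
    have h₁ := hmα m hm
    have h₂ := hmα0 m
    have hact := hno.active hsync hL (t := T + m * E.α) (by linarith) (he.1.mono (by linarith))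
    exact (hsync.delivery _ hL i hi _ _ (hP.broadcast m hact i)).mono (by linarith)
  obtain ⟨e', -, he'⟩ := (he.1.skew hsync hprot hL hi).exists_entersAt
  have he't : e' ≤ t := by
    have := (he.le_firstProposalTime hΔ hsync hprot hL hi he').1
    linarith
  have hent := he'.1.mono he't
  have hmax : ∀ w, E.EnteredBy i w t → w ≤ v :=
    fun w hw => hno.le_of_enteredBy hΔ hsync hi h1 le_rfl hw
  obtain ⟨C, hC⟩ := hP.first.exists_on
  refine ⟨hP.valid k, ?_, hkn k le_rfl, fun A hA _ => ?_, ?_⟩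
  · rw [hP.view]
    exact hno.active hsync hi le_rfl hent
  · rcases hP.suffix_cases hC hA with ⟨m, hm, rfl⟩ | hA
    · exact .inr (.inr ⟨P m, rfl, hkn m hm⟩)
    · rcases hC.backed hsync hprot hL with rfl | ⟨g, hg, Q, hQ, -, r, hr, hV⟩
      · exact .inl (List.suffix_nil.1 hA)
      · exact (hV.hasBlock hsync hprot hg hi (hQ ▸ hA)).mono (by linarith)
  cases hst : (P k).statuses with
  | some S =>
    obtain rfl := hP.eq_zero_of_statuses (k := k) (by simp [hst])
    left
    have hsuf := hP.parent_suffix hC 0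
    obtain ⟨b, -, ⟨-, hS, -⟩ | ⟨-, S', hS, hSk, hCS, hCmax⟩⟩ := hC
    · simp [hst] at hS
    obtain rfl : S = S' := by simpa [hst] using hS
    refine ⟨S, C, rfl, ⟨hCS, ?_⟩, hsuf⟩
    rintro D ⟨σ, hσ, rfl⟩
    have hval := ((hP.valid 0).2.2.2 S hst).2.2 σ hσ
    exact hCmax.2 _ ⟨σ, hval.1, hval.2.trans (hP.view 0), hSk σ hσ, rfl⟩
  | none =>
    refine .inr ⟨rfl, ?_⟩
    have hCk : E.KnownCert i C t := by
      obtain ⟨b, -, ⟨-, -, rfl⟩ | ⟨-, S, hS, -, hCS, -⟩⟩ := hC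
      · exact .inl rfl
      · refine .inr (.inr ⟨P 0, S, hP.valid 0, hS, hCS, ?_, t, le_rfl, fun s hs hen => ?_,
          hkn 0 (Nat.zero_le k)⟩)
        · rwa [hP.view]
        · have := hmax _ (hen.mono hs.le)
          rw [hP.view] at this
          omega
    obtain ⟨D, hD, hDmax⟩ := exists_isHighest_knownCert hsync hi t
    have hDv : D.view ≤ v := by
      rcases KnownCert.backed hsync hprot hi hD with rfl | ⟨g, hg, Q, -, hQ, r, hr, hV⟩
      · exact Nat.zero_le _
      · rw [← hQ]
        exact hno.le_of_enteredBy hΔ hsync hg h1 hr hV.2.1.1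
    -- A highest certificate of view `v` is for a proposal of index at most `k`. One of an earlier
    -- view ranks no higher than `C`, so that `C` is itself a highest known certificate.
    rcases hDv.eq_or_lt with hDv | hDv
    · refine ⟨D, ⟨hD, hDmax⟩, ?_⟩
      rcases KnownCert.backed hsync hprot hi hD with rfl | hV
      · exact List.nil_suffix
      · rw [hDv] at hV
        obtain ⟨m, hm, hmt⟩ := hP.of_honestVote hsync hL hV
        rw [hm]
        refine hP.suffix (Nat.cast_le.1 (le_of_mul_le_mul_right ?_ hα))
        linarith
    · have hDC := KnownCert.rankLE_parent hΔ hsync hprot hL he hP hC hi he' hmax hD hDv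
      exact ⟨C, ⟨hCk, fun F hF => (hDmax F hF).trans hDC⟩, hP.parent_suffix hC k⟩

/-- Honest replicas commit an honest leader's proposal within `3Δ`. -/
theorem Schedule.directCommit (hΔ : 0 < E.Δ) (hα : 0 < E.α) (hsync : E.IsSynchronous)
    (hprot : E.FollowsProtocol) {v : ℕ} (hL : leader f v ∈ E.honest) {e : ℝ}
    (he : E.EntersAt (leader f v) v e) {P : ℕ → Proposal f β} {T : ℝ}
    (hT : E.firstProposalTime v e = T) (hP : E.Schedule v T P)
    {i : Replica f} (hi : i ∈ E.honest) {k : ℕ}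
    (hno : E.NoBlameBefore v (T + k * E.α + 3 * E.Δ)) :
    E.DirectCommit i v (P k).block (T + k * E.α + 3 * E.Δ) := by
  have htc : ∀ j ∈ E.honest, E.TimerCond j (P k) (T + k * E.α + E.Δ) := fun j hj =>
    hP.timerCond hΔ hα hsync hprot hL he hT hj (hno.mono (by linarith))
  have hact : ∀ j ∈ E.honest, E.EnteredBy j v (T + k * E.α + E.Δ) := fun j hj => by
    have := (htc j hj).2.1.1
    rwa [hP.view] at this
  refine ⟨hno.active hsync hi le_rfl ((hact i hi).mono (by linarith)),
    hP.not_equivKnown hsync hL hi _, ?_⟩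
  obtain ⟨H, hH, hHcard⟩ := Finset.exists_subset_card_eq hsync.honest_card
  refine ⟨H, hHcard, fun j hj => ?_⟩
  have hj := hH hj
  -- The `3Δ` consist of the proposal's delay, the timer and the delay of the votes; the timer may
  -- also have started earlier.
  obtain ⟨τ, hτ, hst⟩ := (htc j hj).exists_startsTimer hsync hj
  have hV : E.Votes j (P k) (τ + E.Δ) := by
    refine ⟨by simpa using hst, ?_, ?_⟩
    · have h₁ := hst.1.2.1.1
      rw [hP.view] at h₁ ⊢
      exact hno.active hsync hj (by linarith) (h₁.mono (by linarith))
    · rw [hP.view]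
      exact hP.not_equivKnown hsync hL hj _
  have := hsync.delivery j hj i hi _ _ (hprot.vote j hj (P k) _ hV i)
  rw [hP.view] at this
  exact this.mono (by linarith)

/-- Skew `Δ` plus the leader's wait `2Δ`; with the `3Δ` of `Schedule.directCommit` this makes up the
`6Δ` of the allowance. -/
theorem firstProposalTime_le (hΔ : 0 < E.Δ) (hsync : E.IsSynchronous)
    (hprot : E.FollowsProtocol) {v : ℕ} (hL : leader f v ∈ E.honest) {e e' : ℝ}
    (he : E.EntersAt (leader f v) v e) {i : Replica f} (hi : i ∈ E.honest)
    (he' : E.EntersAt i v e') : E.firstProposalTime v e ≤ e' + 3 * E.Δ := by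
  have := he'.skew hsync hprot hi hL he
  unfold firstProposalTime
  split_ifs <;> linarith

/-- The first `p` proposals of an honest leader are new blocks committed within the allowance. -/
theorem Schedule.le_encard_newBlocks (hΔ : 0 < E.Δ) (hα : 0 < E.α) (hsync : E.IsSynchronous)
    (hprot : E.FollowsProtocol) {v : ℕ} (hL : leader f v ∈ E.honest) {e : ℝ}
    (he : E.EntersAt (leader f v) v e) {P : ℕ → Proposal f β} {T : ℝ}
    (hT : E.firstProposalTime v e = T) (hP : E.Schedule v T P)
    {i : Replica f} (hi : i ∈ E.honest) {e' : ℝ} (he' : E.EntersAt i v e') {p : ℕ}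
    (hno : E.NoBlameBefore v (T + ((p : ℝ) - 1) * E.α + 3 * E.Δ)) :
    (p : ℕ∞) ≤ (E.newBlocks i v (e' + E.allowance p)).encard := by
  have hsub : (fun k => (P k).block) '' (Finset.range p : Set ℕ) ⊆
      E.newBlocks i v (e' + E.allowance p) := by
    rintro _ ⟨k, hk, rfl⟩
    have hkp : (k : ℝ) ≤ (p : ℝ) - 1 := by
      have : k + 1 ≤ p := by simpa using hk
      have : ((k + 1 : ℕ) : ℝ) ≤ p := Nat.cast_le.2 this
      push_cast at this
      linarith
    have hkα := mul_le_mul_of_nonneg_right hkp hα.le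
    have hTe := firstProposalTime_le hΔ hsync hprot hL he hi he'
    have hc := hP.directCommit hΔ hα hsync hprot hL he hT hi (k := k) (hno.mono (by linarith))
    refine ⟨⟨(hP.valid k).2.1, _, List.suffix_rfl, _, ?_, hc⟩,
      fun u hu s => Schedule.not_committedIn hΔ hsync hprot hL he (hT ▸ hP) hi hu k s⟩
    unfold allowance
    linarith
  refine le_trans ?_ (Set.encard_le_encard hsub)
  rw [Set.InjOn.encard_image, Set.encard_coe_eq_coe_finsetCard, Finset.card_range]
  -- Distinct proposals have distinct heights.
  intro k _ m _ hkm
  have h₁ := congrArg List.length hkm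
  simp only [hP.length k, hP.length m] at h₁
  omega

/-- Honest replicas do not blame an honest leader. -/
theorem Schedule.noBlameBefore (hΔ : 0 < E.Δ) (hα : 0 < E.α) (hsync : E.IsSynchronous)
    (hprot : E.FollowsProtocol) {v : ℕ} (hL : leader f v ∈ E.honest) {e : ℝ}
    (he : E.EntersAt (leader f v) v e) {P : ℕ → Proposal f β} {T : ℝ}
    (hT : E.firstProposalTime v e = T) (hP : E.Schedule v T P) (d : ℝ) :
    E.NoBlameBefore v d := by
  suffices key : ∀ k : ℕ, E.NoBlameBefore v (T + k * E.α + 3 * E.Δ) by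
    obtain ⟨k, hk⟩ := exists_nat_gt ((d - T) / E.α)
    rw [div_lt_iff₀ hα] at hk
    exact (key k).mono (by linarith)
  intro k
  induction k using Nat.strong_induction_on with
  | _ k ih =>
    intro i hi j s hs hsend
    obtain ⟨t, hts, -, ⟨e', p, he', hp, ht, hlt⟩ | heq⟩ := hprot.blame_only i hi v j s hsend
    · have hTe := firstProposalTime_le hΔ hsync hprot hL he hi he'
      unfold allowance at ht
      -- The deadline for `p` commits lies before `T + kα + 3Δ ≤ e' + 6Δ + kα`, so `p - 1 < k`, and
      -- the induction hypothesis at `p - 1` gives those commits in time.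
      have hpk : ((p : ℝ) - 1) * E.α < k * E.α := by linarith
      have hpk' := lt_of_mul_lt_mul_right hpk hα.le
      obtain ⟨q, rfl⟩ := Nat.exists_eq_add_of_le' hp
      push_cast at hpk'
      have hqk : q < k := Nat.cast_lt.1 (by linarith : (q : ℝ) < k)
      refine absurd hlt (not_lt.2 (hP.le_encard_newBlocks hΔ hα hsync hprot hL he hT hi he' ?_))
      simpa using ih q hqk
    · exact hP.not_equivKnown hsync hL hi t heq

theorem exists_schedule_of_enteredBy (hΔ : 0 < E.Δ)
    (hvalid : ∀ B : Block β, ∃ b : β, E.valid (b :: B)) (hsync : E.IsSynchronous)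
    (hprot : E.FollowsProtocol) {v : ℕ} (hL : leader f v ∈ E.honest) {i : Replica f}
    (hi : i ∈ E.honest) {t : ℝ} (h : E.EnteredBy i v t) :
    ∃ e, E.EntersAt (leader f v) v e ∧ ∃ P, E.Schedule v (E.firstProposalTime v e) P := by
  obtain ⟨e, -, he⟩ := (h.skew hsync hprot hi hL).exists_entersAt
  exact ⟨e, he, he.exists_schedule hΔ hvalid hsync hprot hL⟩

theorem noBlameBefore_of_honest_leader (hΔ : 0 < E.Δ) (hα : 0 < E.α)
    (hvalid : ∀ B : Block β, ∃ b : β, E.valid (b :: B)) (hsync : E.IsSynchronous)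
    (hprot : E.FollowsProtocol) {v : ℕ} (hL : leader f v ∈ E.honest) (d : ℝ) :
    E.NoBlameBefore v d := by
  intro i hi j s hs hsend
  obtain ⟨t, -, hact, -⟩ := hprot.blame_only i hi v j s hsend
  obtain ⟨e, he, P, hP⟩ := exists_schedule_of_enteredBy hΔ hvalid hsync hprot hL hi hact.1
  exact hP.noBlameBefore hΔ hα hsync hprot hL he rfl d i hi j s hs hsend

theorem not_enteredBy_of_honest_leader (hΔ : 0 < E.Δ) (hα : 0 < E.α)
    (hvalid : ∀ B : Block β, ∃ b : β, E.valid (b :: B)) (hsync : E.IsSynchronous)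
    (hprot : E.FollowsProtocol) {v : ℕ} (hv : 1 ≤ v) (hL : leader f v ∈ E.honest) {i : Replica f}
    (hi : i ∈ E.honest) (t : ℝ) : ¬ E.EnteredBy i (v + 1) t := by
  intro h
  have := (noBlameBefore_of_honest_leader hΔ hα hvalid hsync hprot hL t).le_of_enteredBy
    hΔ hsync hi hv le_rfl h
  omega

/-! ### Replacement of faulty leaders -/

theorem Reached.replaced (hsync : E.IsSynchronous) (hprot : E.FollowsProtocol) {v : ℕ}
    (h : E.Reached (v + 1)) : E.Replaced v := by
  obtain ⟨i, hi, t, ht⟩ := h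
  exact fun j hj => ⟨_, ht.skew hsync hprot hi hj⟩

theorem reached_one (hsync : E.IsSynchronous) : E.Reached 1 := by
  obtain ⟨i, hi⟩ := exists_honest hsync
  exact ⟨i, hi, E.start i, le_refl (E.start i)⟩

theorem Reached.enteredBy (hsync : E.IsSynchronous) (hprot : E.FollowsProtocol) {v : ℕ}
    (h : E.Reached v) {i : Replica f} (hi : i ∈ E.honest) : ∃ t, E.EnteredBy i v t := by
  obtain ⟨j, hj, t, ht⟩ := h
  exact ⟨_, ht.skew hsync hprot hj hi⟩

theorem not_hasBlameCert_of_not_reached {v : ℕ} (h : ¬ E.Reached (v + 1)) {i : Replica f}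
    (hi : i ∈ E.honest) {t : ℝ} (ht : E.EnteredBy i v t) (s : ℝ) : ¬ E.HasBlameCert i v s := by
  intro hb
  refine h ⟨i, hi, max s t + 2 * E.Δ, ?_⟩
  rw [enteredBy_succ ht.one_le]
  exact ⟨ht.mono (by linarith [le_max_right s t]), hb.mono (by linarith [le_max_left s t])⟩

/-- The honest replicas alone can replace a leader. -/
theorem reached_succ_of_blame (hsync : E.IsSynchronous) (hprot : E.FollowsProtocol) {v : ℕ}
    (hv : E.Reached v)
    (h : ¬ E.Reached (v + 1) → ∀ i ∈ E.honest, ∃ t, E.Late i v t ∨ E.EquivKnown i v t) :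
    E.Reached (v + 1) := by
  by_contra hno
  -- If view `v + 1` is never entered, no honest replica ever holds a blame certificate, so all stay
  -- active and send every blame that is due.
  have hb : ∀ i ∈ E.honest, ∃ t, E.BroadcastBy i (.blame i v) t := by
    intro i hi
    obtain ⟨s, hs⟩ := hv.enteredBy hsync hprot hi
    obtain ⟨t, ht⟩ := h hno i hi
    refine ⟨max s t, hprot.blame i hi v _ ⟨hs.mono (le_max_left _ _), fun r _ =>
      not_hasBlameCert_of_not_reached hno hi hs r⟩ ?_⟩
    rcases ht with ⟨e, p, he, hp, hle, hlt⟩ | ht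
    · exact .inl ⟨e, p, he, hp, hle.trans (le_max_right _ _), hlt⟩
    · exact .inr (ht.mono (le_max_right _ _))
  choose! b hb using hb
  obtain ⟨i, hi⟩ := exists_honest hsync
  obtain ⟨s, hs⟩ := hv.enteredBy hsync hprot hi
  obtain ⟨H, hH, hHcard⟩ := Finset.exists_subset_card_eq hsync.honest_card
  obtain ⟨k, hk, hmax⟩ := H.exists_max_image b (Finset.card_pos.1 (by omega))
  exact not_hasBlameCert_of_not_reached hno hi hs (b k + E.Δ) ⟨H, hHcard, fun j hj =>
    ((hb j (hH hj)).knows hsync (hH hj) hi).mono (by linarith [hmax j hj])⟩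

/-- In a view that is never left, replicas stay active and forward even proposals received before
entering, hence the `max`. -/
theorem knows_of_reachesHonest (hsync : E.IsSynchronous) (hprot : E.FollowsProtocol) {v : ℕ}
    (hv : E.Reached v) (hno : ¬ E.Reached (v + 1)) {P : Proposal f β} (hP : P.Valid E.valid)
    (hPv : P.view = v) (h : E.ReachesHonest P) {j : Replica f} (hj : j ∈ E.honest) :
    ∃ t, E.Knows j (.propose P) t := by
  obtain ⟨i, hi, t, ht⟩ := h
  obtain ⟨s, hs⟩ := hv.enteredBy hsync hprot hi
  have hact : E.Active i P.view (max s t) := by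
    rw [hPv]
    exact ⟨hs.mono (le_max_left _ _), fun r _ => not_hasBlameCert_of_not_reached hno hi hs r⟩
  exact ⟨_, (hprot.forward i hi P _ hP hact (ht.mono (le_max_right _ _))).knows hsync hi hj⟩

theorem replaced_of_equivocates (hsync : E.IsSynchronous) (hprot : E.FollowsProtocol) {v : ℕ}
    (hv : E.Reached v) {P Q : Proposal f β} (hP : P.Valid E.valid) (hQ : Q.Valid E.valid)
    (hPv : P.view = v) (hQv : Q.view = v) (hPQ : P.Equivocates Q) (hPr : E.ReachesHonest P)
    (hQr : E.ReachesHonest Q) : E.Replaced v := by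
  refine (reached_succ_of_blame hsync hprot hv fun hno i hi => ?_).replaced hsync hprot
  obtain ⟨s, hs⟩ := knows_of_reachesHonest hsync hprot hv hno hP hPv hPr hi
  obtain ⟨t, ht⟩ := knows_of_reachesHonest hsync hprot hv hno hQ hQv hQr hi
  exact ⟨max s t, .inr ⟨P, Q, hP, hQ, hPv, hQv, hPQ, hs.mono (le_max_left _ _),
    ht.mono (le_max_right _ _)⟩⟩

theorem replaced_of_late (hsync : E.IsSynchronous) (hprot : E.FollowsProtocol) {v : ℕ}
    (hv : E.Reached v) (h : ∀ i ∈ E.honest, ∀ e, E.EntersAt i v e →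
      ∃ p : ℕ, 1 ≤ p ∧ (E.newBlocks i v (e + E.allowance p)).encard < p) : E.Replaced v := by
  refine (reached_succ_of_blame hsync hprot hv fun _ i hi => ?_).replaced hsync hprot
  obtain ⟨s, hs⟩ := hv.enteredBy hsync hprot hi
  obtain ⟨e, -, he⟩ := hs.exists_entersAt
  obtain ⟨p, hp, hlt⟩ := h i hi e he
  exact ⟨_, .inl ⟨e, p, he, hp, le_rfl, hlt⟩⟩

theorem finite_suffixes {B : Block β} : {A | A <:+ B}.Finite := by
  refine (List.finite_toSet B.tails).subset fun A hA => ?_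
  exact (List.mem_tails _ _).2 hA

/-- Each committed block is an ancestor of a block with an honest vote, hence of a received valid
proposal. This bounds the number of commits, and one more than the bound is missed. -/
theorem replaced_of_finite_proposals (hsync : E.IsSynchronous) (hprot : E.FollowsProtocol)
    {v : ℕ} (hv : E.Reached v)
    (hfin : {P : Proposal f β | P.Valid E.valid ∧ P.view = v ∧ E.ReachesHonest P}.Finite) :
    E.Replaced v := by
  have hF := hfin.biUnion fun P _ => finite_suffixes (B := P.block)
  refine replaced_of_late hsync hprot hv fun i hi e _ => ⟨hF.toFinset.card + 1, by omega, ?_⟩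
  have hsub : E.newBlocks i v (e + E.allowance (hF.toFinset.card + 1)) ⊆ hF.toFinset := by
    rintro B ⟨⟨-, B', hB, s, -, hc⟩, -⟩
    obtain ⟨h, hh, P, rfl, hPv, t, -, hV⟩ := hc.2.2.honestVote hsync hprot hi
    rw [Set.Finite.coe_toFinset]
    exact Set.mem_biUnion (show P ∈ {P : Proposal f β | _} from
      ⟨hV.1.1.1, hPv, h, hh, _, hV.1.1.2.2.1⟩) hB
  refine (Set.encard_le_encard hsub).trans_lt ?_
  rw [Set.encard_coe_eq_coe_finsetCard]
  exact_mod_cast Nat.lt_succ_self _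

/-! ### The last view and unending progress -/

theorem finite_committed (hsync : E.IsSynchronous) {i : Replica f} (hi : i ∈ E.honest) (t : ℝ) :
    {B | E.Committed i B t}.Finite := by
  have hX := hsync.finite_arrivals i hi t
  -- Every committed block is an ancestor of the block of some received vote.
  have hF : (⋃ x ∈ {x | E.Knows i x t},
      {B : Block β | ∃ j B' v, x = .vote j B' v ∧ B <:+ B'}).Finite := by
    refine hX.biUnion fun x _ => ?_
    by_cases hx : ∃ j B' v, x = .vote j B' v
    · obtain ⟨j, B', v, rfl⟩ := hx
      refine (finite_suffixes (B := B')).subset ?_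
      rintro B ⟨k, B'', w, h, hB⟩
      simp only [Item.vote.injEq] at h
      exact h.2.1 ▸ hB
    · refine Set.finite_empty.subset ?_
      rintro B ⟨j, B', v, h, -⟩
      exact hx ⟨j, B', v, h⟩
  refine hF.subset ?_
  rintro B ⟨v, -, B', hB, s, hs, -, -, Q, hQ, hk⟩
  obtain ⟨j, hj⟩ := Finset.card_pos.1 (by omega : 0 < Q.card)
  exact Set.mem_biUnion (show E.Knows i (.vote j B' v) t from (hk j hj).mono hs)
    ⟨j, B', v, rfl, hB⟩

/-- There is a last view. -/
theorem exists_last_view (hΔ : 0 < E.Δ) (hα : 0 < E.α)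
    (hvalid : ∀ B : Block β, ∃ b : β, E.valid (b :: B)) (hsync : E.IsSynchronous)
    (hprot : E.FollowsProtocol) : ∃ w, E.Reached w ∧ ¬ E.Reached (w + 1) := by
  by_contra! hcon
  have hall : ∀ v, E.Reached (v + 1) := by
    intro v
    induction v with
    | zero => exact reached_one hsync
    | succ v ih => exact hcon _ ih
  obtain ⟨l, hl⟩ := exists_honest hsync
  -- Adding one full round makes the view number positive even for replica `0`.
  have hlead : leader f (l + (2 * f + 1)) = l := by
    apply Fin.ext
    simp [leader, Nat.mod_eq_of_lt l.2]
  obtain ⟨i, hi, t, ht⟩ := hall (l + (2 * f + 1))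
  exact not_enteredBy_of_honest_leader hΔ hα hvalid hsync hprot (by omega)
    (by rw [hlead]; exact hl) hi t ht

/-- In the last view, all honest replicas commit what one of them commits. -/
theorem CommittedIn.of_last_view (hsync : E.IsSynchronous) (hprot : E.FollowsProtocol) {w : ℕ}
    (hw : E.Reached w) (hno : ¬ E.Reached (w + 1)) {i j : Replica f} (hi : i ∈ E.honest)
    (hj : j ∈ E.honest) {B : Block β} {t : ℝ} (h : E.CommittedIn i w B t) :
    ∃ t', E.CommittedIn j w B t' := by
  obtain ⟨hB, B', hBB, s, -, hc⟩ := h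
  obtain ⟨Q, hQ, hb⟩ := hprot.commit i hi w B' s hc
  obtain ⟨r, hr⟩ := hw.enteredBy hsync hprot hj
  refine ⟨_, hB, B', hBB, max r (s + E.Δ), le_rfl, ⟨hr.mono (le_max_left _ _), fun q _ =>
    not_hasBlameCert_of_not_reached hno hj hr q⟩, ?_, Q, hQ, fun k hk =>
      ((hb k hk).2.knows hsync hi hj).mono (le_max_right _ _)⟩
  -- A known equivocation would have the leader of the last view replaced.
  rintro ⟨P, P', hP, hP', hPv, hPv', hPP, h₁, h₂⟩
  obtain ⟨q, hq⟩ := replaced_of_equivocates hsync hprot hw hP hP' hPv hPv' hPP ⟨j, hj, _, h₁⟩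
    ⟨j, hj, _, h₂⟩ j hj
  exact hno ⟨j, hj, q, hq⟩

theorem keeps_committing (hΔ : 0 < E.Δ) (hα : 0 < E.α)
    (hvalid : ∀ B : Block β, ∃ b : β, E.valid (b :: B)) (hsync : E.IsSynchronous)
    (hprot : E.FollowsProtocol) {i : Replica f} (hi : i ∈ E.honest) (t : ℝ) :
    ∃ t' > t, ∃ B : Block β, E.Committed i B t' ∧ ¬ E.Committed i B t := by
  obtain ⟨w, hw, hno⟩ := exists_last_view hΔ hα hvalid hsync hprot
  by_cases hlate : ∀ j ∈ E.honest, ∀ e, E.EntersAt j w e →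
      ∃ p : ℕ, 1 ≤ p ∧ (E.newBlocks j w (e + E.allowance p)).encard < p
  · obtain ⟨s, hs⟩ := replaced_of_late hsync hprot hw hlate i hi
    exact absurd ⟨i, hi, s, hs⟩ hno
  push Not at hlate
  obtain ⟨j, hj, e, -, hp⟩ := hlate
  have hF := finite_committed hsync hi t
  -- Being never late, `j` commits more blocks in view `w` than `i` has committed by `t`, so one of
  -- them is still missing at `i`.
  have hlt : {B | E.Committed i B t}.encard <
      (E.newBlocks j w (e + E.allowance (hF.toFinset.card + 1))).encard := by
    refine lt_of_lt_of_le ?_ (hp (hF.toFinset.card + 1) (by omega))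
    rw [hF.encard_eq_coe_toFinset_card]
    exact_mod_cast Nat.lt_succ_self _
  obtain ⟨B, hB, hBt⟩ :=
    Set.not_subset.1 fun h => absurd hlt (not_lt.2 (Set.encard_le_encard h))
  obtain ⟨t', ht'⟩ := hB.1.of_last_view hsync hprot hw hno hj hi
  refine ⟨max t' (t + 1), lt_of_lt_of_le (by linarith) (le_max_right _ _), B,
    ⟨w, ht'.mono (le_max_left _ _)⟩, hBt⟩

end Execution

end DeltaSMR

theorem mainTheorem4 {β : Type*} (f : ℕ) (E : DeltaSMR.Execution f β)
    (hΔ : 0 < E.Δ) (hα : 0 < E.α)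
    -- honest replicas are always able to generate a valid next block
    (hvalid : ∀ B : DeltaSMR.Block β, ∃ b : β, E.valid (b :: B))
    (hsync : E.IsSynchronous) (hprot : E.FollowsProtocol) :
    -- all honest replicas keep committing new blocks
    (∀ i ∈ E.honest, ∀ t : ℝ, ∃ t' > t, ∃ B : DeltaSMR.Block β,
      E.Committed i B t' ∧ ¬ E.Committed i B t) ∧
    -- an honest leader is never blamed or replaced; `p` blocks commit within `6Δ + (p - 1)α`
    (∀ v : ℕ, 1 ≤ v → DeltaSMR.leader f v ∈ E.honest → ∀ i ∈ E.honest,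
      (∀ (e : ℝ) (p : ℕ), E.EntersAt i v e → 1 ≤ p →
        (p : ℕ∞) ≤ (E.newBlocks i v (e + (6 * E.Δ + ((p : ℝ) - 1) * E.α))).encard) ∧
      (∀ (j : DeltaSMR.Replica f) (s : ℝ), ¬ E.sends i j (.blame i v) s) ∧
      (∀ t : ℝ, ¬ E.EnteredBy i (v + 1) t)) ∧
    -- a leader that equivocates towards honest replicas is replaced
    (∀ v : ℕ, E.Reached v →
      (∃ P Q : DeltaSMR.Proposal f β, P.Valid E.valid ∧ Q.Valid E.valid ∧ P.view = v ∧
        Q.view = v ∧ P.Equivocates Q ∧ E.ReachesHonest P ∧ E.ReachesHonest Q) →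
      E.Replaced v) ∧
    -- a leader under which no honest replica always commits in time is replaced
    (∀ v : ℕ, E.Reached v →
      (∀ i ∈ E.honest, ∀ e : ℝ, E.EntersAt i v e → ∃ p : ℕ, 1 ≤ p ∧
        (E.newBlocks i v (e + (6 * E.Δ + ((p : ℝ) - 1) * E.α))).encard < p) →
      E.Replaced v) ∧
    -- in particular, so is a leader of which only finitely many valid proposals are received
    (∀ v : ℕ, E.Reached v →
      {P : DeltaSMR.Proposal f β | P.Valid E.valid ∧ P.view = v ∧ E.ReachesHonest P}.Finite →
      E.Replaced v) := by
  refine ⟨fun i hi t => DeltaSMR.Execution.keeps_committing hΔ hα hvalid hsync hprot hi t,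
    fun v hv hL i hi => ⟨fun e p he _ => ?_, fun j s => ?_, fun t => ?_⟩,
    fun v hv ⟨P, Q, hP, hQ, hPv, hQv, hPQ, hPr, hQr⟩ =>
      DeltaSMR.Execution.replaced_of_equivocates hsync hprot hv hP hQ hPv hQv hPQ hPr hQr,
    fun v hv h => DeltaSMR.Execution.replaced_of_late hsync hprot hv h,
    fun v hv h => DeltaSMR.Execution.replaced_of_finite_proposals hsync hprot hv h⟩
  · obtain ⟨e', he', P, hP⟩ :=
      DeltaSMR.Execution.exists_schedule_of_enteredBy hΔ hvalid hsync hprot hL hi he.1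
    exact hP.le_encard_newBlocks hΔ hα hsync hprot hL he' rfl hi he
      (hP.noBlameBefore hΔ hα hsync hprot hL he' rfl _)
  · exact DeltaSMR.Execution.noBlameBefore_of_honest_leader hΔ hα hvalid hsync hprot hL (s + 1)
      i hi j s (lt_add_one s)
  · exact DeltaSMR.Execution.not_enteredBy_of_honest_leader hΔ hα hvalid hsync hprot hv hL hi t
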